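/- Let $\Sigma$ be a finite set, $P=(p(x,y))_{x,y\in\Sigma}$ an irreducible stochastic matrix with invariant distribution $\pi$, $\nu$ a probability distribution on $\Sigma$, and $\mu:\Sigma\to(0,\infty)$ an arbitrary measure of full support. Put $\pi_\star=\min_z\pi(z)$, $g(z)=\pi(z)/\mu(z)$, $\rho_z(x)=p(x,z)/\mu(z)$, $\mathrm{Var}_\pi f=\sum_x\pi(x)\bigl(f(x)-\sum_y\pi(y)f(y)\bigr)^2$, and let $$T=\min\Bigl\{n\ge 0:\ \max_{x\in\Sigma}\tfrac12\sum_{y\in\Sigma}|P^n(x,y)-\pi(y)|\le\tfrac14\Bigr\}$$ be the mixing time ($T=\infty$ if there is no such $n$). There are absolute constants $c,C\in(0,\infty)$, not depending on any of these data, such that the following holds. **Theorem.** There is a probability space $(\Omega,\mathcal F,\mathbb Q)$ carrying a Markov chain $(Z_i)_{i\ge0}$ with transition matrix $P$ and initial distribution $\nu$, and an i.i.d. sequence $(U_i)_{i\ge0}$ with marginal $\pi$, such that, if $T<\infty$, then for every real $\varepsilon$ with $$0<\varepsilon\le\frac12\wedge\min_{z\in\Sigma}\frac{\mathrm{Var}_\pi\rho_z}{2\|\rho_z\|_\infty\,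 g(z)}$$ and every integer $n\ge 2k(\varepsilon)T$, where $$k(\varepsilon)=-\min_{z\in\Sigma}\log_2\frac{\pi_\star\,\varepsilon^2g(z)^2}{6\,\mathrm{Var}_\pi\rho_z},$$ the event $$\mathcal G(n,\varepsilon)=\Bigl\{\{U_i\}_{0\le i\le n(1-\varepsilon)}\subset\{Z_i\}_{0\le i\le n}\subset\{U_i\}_{0\le i\le n(1+\varepsilon)}\Bigr\}$$ satisfies $$\mathbb Q\bigl[\mathcal G(n,\varepsilon)^c\bigr]\le C\sum_{z\in\Sigma}\Bigl(e^{-cn\varepsilon^2}+e^{-cn\varepsilon\frac{\pi(z)}{\nu(z)}}+\exp\Bigl\{-\frac{c\,\varepsilon^2g(z)^2}{\mathrm{Var}_\pi\rho_z}\,\frac{n}{k(\varepsilon)T}\Bigr\}\Bigr),$$ where the second exponential is read as $0$ when $\nu(z)=0$. The coupling does not depend on $\varepsilon$ or $n$. -/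

import Mathlib

open MeasureTheory ProbabilityTheory

universe u

namespace ChainCoupling

noncomputable section

/-- `π` is an invariant probability distribution of the transition matrix `P`. -/
def IsInvariantDistribution {S : Type*} [Fintype S] (P : Matrix S S ℝ) (π : S → ℝ) : Prop :=
  π ∈ stdSimplex ℝ S ∧ Matrix.vecMul π P = π

/-- Total variation distance `(1/2) ∑ₓ |α(x) - β(x)|` on a finite set. -/
def tvDist {S : Type*} [Fintype S] (α β : S → ℝ) : ℝ :=
  (1 / 2) * ∑ x, |α x - β x|

/-- `T` is the mixing time, i.e. the least `n ≥ 0` such that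
`max_x ‖Pⁿ(x, ·) - π‖_TV ≤ 1/4`. No `T` satisfies this when there is no such `n`
(that is, when the mixing time is infinite, as for periodic chains). -/
def IsMixingTime {S : Type*} [Fintype S] [DecidableEq S] (P : Matrix S S ℝ) (π : S → ℝ)
    (T : ℕ) : Prop :=
  IsLeast {n : ℕ | ∀ x, tvDist ((P ^ n) x) π ≤ 1 / 4} T

/-- `π_⋆ = min_z π(z)`. -/
def piStar {S : Type*} (π : S → ℝ) : ℝ := ⨅ z, π z

/-- `π(f) = ∑ₓ π(x) f(x)`. -/
def piMean {S : Type*} [Fintype S] (π f : S → ℝ) : ℝ := ∑ x, π x * f x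

/-- `Var_π f = π((f - π(f))²)`. -/
def piVar {S : Type*} [Fintype S] (π f : S → ℝ) : ℝ :=
  piMean π (fun x => (f x - piMean π f) ^ 2)

/-- The density `g = π / μ` of `π` with respect to `μ`. -/
def density {S : Type*} (π μ : S → ℝ) (x : S) : ℝ := π x / μ x

/-- The function `ρ_z : x ↦ ρ(x, z) = p(x, z) / μ(z)`. -/
def rho {S : Type*} (P : Matrix S S ℝ) (μ : S → ℝ) (z : S) : S → ℝ :=
  fun x => P x z / μ z

/-- `k(ε) = - min_z log₂ (π_⋆ ε² g(z)² / (6 Var_π ρ_z))`. -/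
def kFun {S : Type*} [Fintype S] (P : Matrix S S ℝ) (π μ : S → ℝ) (ε : ℝ) : ℝ :=
  - ⨅ z, Real.logb 2 (piStar π * ε ^ 2 * density π μ z ^ 2 / (6 * piVar π (rho P μ z)))

/-- The largest admissible `ε`, namely
`(1/2) ∧ min_z Var_π ρ_z / (2 ‖ρ_z‖_∞ g(z))`; the norm on `S → ℝ` is the sup norm. -/
def epsMax {S : Type*} [Fintype S] (P : Matrix S S ℝ) (π μ : S → ℝ) : ℝ :=
  min (1 / 2) (⨅ z, piVar π (rho P μ z) / (2 * ‖rho P μ z‖ * density π μ z))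

/-- `Z` is, under `Q`, a Markov chain with transition matrix `P` and initial distribution `ν`. -/
structure IsMarkovChain {S Ω : Type*} [MeasurableSpace S] [MeasurableSpace Ω]
    (P : Matrix S S ℝ) (ν : S → ℝ) (Q : Measure Ω) (Z : ℕ → Ω → S) : Prop where
  measurable : ∀ i, Measurable (Z i)
  path_law : ∀ (n : ℕ) (x : ℕ → S),
    Q.real {ω | ∀ i ≤ n, Z i ω = x i} = ν (x 0) * ∏ i ∈ Finset.range n, P (x i) (x (i + 1))

/-- `U` is, under `Q`, an i.i.d. sequence with marginal `π`. -/
structure IsIID {S Ω : Type*} [MeasurableSpace S] [MeasurableSpace Ω]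
    (π : S → ℝ) (Q : Measure Ω) (U : ℕ → Ω → S) : Prop where
  measurable : ∀ i, Measurable (U i)
  indep : iIndepFun U Q
  marginal : ∀ i x, Q.real {ω | U i ω = x} = π x

/-- The partial range `{X_i(ω) : 0 ≤ i ≤ t}`, for real `t`. -/
def rangeUpTo {S Ω : Type*} (X : ℕ → Ω → S) (t : ℝ) (ω : Ω) : Set S :=
  {x | ∃ i : ℕ, (i : ℝ) ≤ t ∧ X i ω = x}

/-- The good event `{U_i}_{i ≤ n(1-ε)} ⊆ {Z_i}_{i ≤ n} ⊆ {U_i}_{i ≤ n(1+ε)}`. -/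
def goodEvent {S Ω : Type*} (Z U : ℕ → Ω → S) (n : ℕ) (ε : ℝ) : Set Ω :=
  {ω | rangeUpTo U (n * (1 - ε)) ω ⊆ rangeUpTo Z n ω ∧
    rangeUpTo Z n ω ⊆ rangeUpTo U (n * (1 + ε)) ω}

/-- `exp(-a π(z) / ν(z))`, read as `exp(-∞) = 0` when `ν(z) = 0`. -/
def initTerm {S : Type*} (π ν : S → ℝ) (a : ℝ) (z : S) : ℝ :=
  open Classical in if ν z = 0 then 0 else Real.exp (-(a * (π z / ν z)))

end

end ChainCoupling

/-!
The proof uses soft local times. Attach to every step of a chain an independent standard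
exponential holding time `ξ`, and let the soft local time at `z` grow at step `i` by `ξ i` times
the conditional probability of jumping to `z` (`softTime`). By memorylessness of competing
exponential clocks (`lintegral_competing_clocks`), the soft local times at which the various states
are visited for the first time (`firstLevel`) are independent standard exponential variables,
whatever the chain (`map_firstLevel_eq_pi`): for thresholds `t`, the conditional probability that
all first visits respect `t` is an explicit martingale (`respectsMartingale`). This applies both to
the Markov chain and to the i.i.d. sequence, which is the chain with constant transition
probabilities `π`, so that the two systems can be coupled with identical levels of first visits
(`exists_coupling_of_map_eq`). A state has been visited by a system precisely when the soft local
time there has passed this common level; hence the inclusions of the ranges follow from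
comparisons of soft local times (`mem_goodEvent`).

It remains to show that the soft local times are concentrated. For the i.i.d. sequence they are
multiples of sums of exponential times. For the chain, integrating out the holding times leaves an
exponential moment of an additive functional of the chain (`lintegral_exp_hold_le_state`). By
convexity it is bounded by the average over the residue classes of times modulo `m`, and within a
class consecutive times are `m` steps apart, so that the moments multiply up to the relative error
of the `m`-step transition probabilities (`lintegral_exp_average_le`). Taking `m` to be three times
`⌈k(ε)⌉ T` makes this error small compared with `ε² g(z)² / Var ρ_z` (`exists_mixing_steps`), and an
exponential Markov inequality gives `measure_softTime_deviation_le`. The incomplete last block and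
the first block only cost constant factors, because the exponent used for a full block is at most
`ε g ‖ρ_z‖ / (64 Var ρ_z) ≤ 1 / 128` per step. The initial step contributes an exponential variable
times `ν(z)`, whence the second exponential of the bound. The reference measure `μ` cancels
throughout.
-/


namespace SoftLocalTime

open Set Filter Topology
open scoped ENNReal

noncomputable section

/-! ### Exponential clocks -/

section

instance : IsProbabilityMeasure (expMeasure 1) := isProbabilityMeasure_expMeasure one_pos

lemma lintegral_expMeasure_one {f : ℝ → ℝ≥0∞} (hf : Measurable f) :
    ∫⁻ s, f s ∂expMeasure 1 = ∫⁻ s in Ioi (0 : ℝ), ENNReal.ofReal (Real.exp (-s)) * f s := by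
  have h : expMeasure 1 = volume.withDensity (exponentialPDF 1) := rfl
  have hm : Measurable (exponentialPDF 1) :=
    (measurable_exponentialPDFReal 1).ennreal_ofReal
  rw [h, lintegral_withDensity_eq_lintegral_mul _ hm hf, ← lintegral_indicator measurableSet_Ioi]
  refine lintegral_congr_ae ?_
  have h0 : ∀ᵐ s : ℝ, s ≠ 0 := by simp [ae_iff]
  filter_upwards [h0] with s hs
  rcases lt_or_gt_of_ne hs with h | h
  · simp [exponentialPDF_of_neg h, h.le]
  · simp [exponentialPDF_of_nonneg h.le, h]

lemma ae_pos_expMeasure_one : ∀ᵐ s ∂expMeasure 1, 0 < s := by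
  have hm : MeasurableSet {s : ℝ | ¬ 0 < s} := measurableSet_Ioi.compl
  have hm1 : Measurable ({s : ℝ | ¬ 0 < s}.indicator (1 : ℝ → ℝ≥0∞)) :=
    measurable_one.indicator hm
  rw [ae_iff, ← lintegral_indicator_one hm, lintegral_expMeasure_one hm1,
    setLIntegral_eq_zero_iff measurableSet_Ioi]
  · refine Eventually.of_forall fun s hs => ?_
    simp [not_le.2 (mem_Ioi.1 hs)]
  · exact (by fun_prop : Measurable fun s : ℝ => ENNReal.ofReal (Real.exp (-s))).mul hm1

lemma inv_one_sub_le_exp {a : ℝ} (ha : |a| ≤ 1 / 4) : 1 / (1 - a) ≤ Real.exp (a + a ^ 2) := by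
  have h1 : |a| < 1 := by linarith
  have h := Real.abs_log_sub_add_sum_range_le h1 2
  have hpos : 0 < 1 - a := by linarith [le_abs_self a]
  rw [← Real.log_le_iff_le_exp (by positivity), one_div, Real.log_inv]
  simp only [Finset.sum_range_succ, Finset.sum_range_zero] at h
  have h2 := (abs_le.1 h).1
  have h3 : |a| ^ (2 + 1) / (1 - |a|) ≤ a ^ 2 / 2 := by
    rw [div_le_iff₀ (by linarith), ← sq_abs a]
    have := abs_nonneg a
    nlinarith [mul_nonneg (sq_nonneg |a|) (sub_nonneg.2 ha)]
  norm_num at h2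
  linarith

/-- The Laplace transform of the exponential law is subquadratic near the origin. -/
lemma lintegral_exp_mul_expMeasure_le {a : ℝ} (ha : |a| ≤ 1 / 4) :
    ∫⁻ s, ENNReal.ofReal (Real.exp (a * s)) ∂expMeasure 1 ≤
      ENNReal.ofReal (Real.exp (a + a ^ 2)) := by
  have hpos : 0 < 1 - a := by linarith [le_abs_self a]
  rw [lintegral_expMeasure_one (by fun_prop)]
  have h1 : ∀ s : ℝ, ENNReal.ofReal (Real.exp (-s)) * ENNReal.ofReal (Real.exp (a * s)) =
      ENNReal.ofReal (Real.exp ((a - 1) * s)) := by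
    intro s
    rw [← ENNReal.ofReal_mul (Real.exp_pos _).le, ← Real.exp_add]
    ring_nf
  simp_rw [h1]
  rw [← ofReal_integral_eq_lintegral_ofReal
      (integrableOn_exp_mul_Ioi (by linarith) 0) (Eventually.of_forall fun s => (Real.exp_pos _).le),
    integral_exp_mul_Ioi (by linarith)]
  apply ENNReal.ofReal_le_ofReal
  refine le_trans (le_of_eq ?_) (inv_one_sub_le_exp ha)
  have : a - 1 ≠ 0 := by linarith
  field_simp
  simp

lemma expMeasure_one_Ici_of_nonneg {b : ℝ} (hb : 0 ≤ b) :
    expMeasure 1 (Ici b) = ENNReal.ofReal (Real.exp (-b)) := by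
  rw [← lintegral_indicator_one measurableSet_Ici,
    lintegral_expMeasure_one (measurable_one.indicator measurableSet_Ici)]
  have h1 : ∫⁻ s in Ioi (0 : ℝ), ENNReal.ofReal (Real.exp (-s)) * (Ici b).indicator 1 s =
      ∫⁻ s in Ioi b, ENNReal.ofReal (Real.exp (-s)) := by
    rw [← lintegral_indicator measurableSet_Ioi, ← lintegral_indicator measurableSet_Ioi]
    refine lintegral_congr_ae ?_
    have h0 : ∀ᵐ s : ℝ, s ≠ b := by simp [ae_iff]
    filter_upwards [h0] with s hs
    rcases lt_or_gt_of_ne hs with h | h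
    · simp [h.le, not_le.2 h]
    · simp [h, h.le, hb.trans_lt h]
  rw [h1, ← ofReal_integral_eq_lintegral_ofReal
    (integrableOn_exp_neg_Ioi b)
    (Eventually.of_forall fun s => (Real.exp_pos _).le)]
  rw [integral_exp_neg_Ioi]

lemma expMeasure_one_Ici (b : ℝ) :
    expMeasure 1 (Ici b) = ENNReal.ofReal (Real.exp (-max b 0)) := by
  rcases le_total 0 b with hb | hb
  · rw [max_eq_left hb, expMeasure_one_Ici_of_nonneg hb]
  · rw [max_eq_right hb]
    refine le_antisymm (prob_le_one.trans (by simp)) ?_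
    rw [← expMeasure_one_Ici_of_nonneg le_rfl]
    exact measure_mono (Ici_subset_Ici.2 hb)

variable {S : Type*} [Fintype S]

/-- Competing exponential clocks: among independent clocks with rates `r z` and residual
thresholds `R z`, the probability that all thresholds are passed is unchanged by running the
clocks until the first ring. -/
lemma lintegral_competing_clocks (r : stdSimplex ℝ S) (R : S → ℝ) :
    ∑ z, ENNReal.ofReal (r.1 z) * ∫⁻ s, (if R z ≤ r.1 z * s then
        ENNReal.ofReal (Real.exp (-∑ w, max (R w - r.1 w * s) 0)) else 0) ∂expMeasure 1 =
      ENNReal.ofReal (Real.exp (-∑ w, max (R w) 0)) := by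
  have hr0 : ∀ z, 0 ≤ r.1 z := r.2.1
  have hr1 : ∑ z, r.1 z = 1 := r.2.2
  set E : ℝ → ℝ := fun s => Real.exp (-s) * Real.exp (-∑ w, max (R w - r.1 w * s) 0) with hE
  set f' : ℝ → ℝ := fun s => -(E s * ∑ z, if R z ≤ r.1 z * s then r.1 z else 0) with hf'
  have hEc : Continuous E := by fun_prop
  have hderiv : ∀ s : ℝ, HasDerivWithinAt E (f' s) (Ioi s) s := by
    intro s
    have h1 : ∀ w, HasDerivWithinAt (fun s => max (R w - r.1 w * s) 0)
        (if R w ≤ r.1 w * s then 0 else - r.1 w) (Ioi s) s := by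
      intro w
      split_ifs with h
      · refine (hasDerivWithinAt_const s (Ioi s) (0 : ℝ)).congr ?_ ?_
        · intro x hx
          have := mul_le_mul_of_nonneg_left (le_of_lt (mem_Ioi.1 hx)) (hr0 w)
          exact max_eq_right (by linarith)
        · exact max_eq_right (by linarith)
      · have hlin : HasDerivAt (fun s => R w - r.1 w * s) (- r.1 w) s := by
          simpa using ((hasDerivAt_id s).const_mul (r.1 w)).const_sub (R w)
        refine (hlin.congr_of_eventuallyEq ?_).hasDerivWithinAt
        have : ∀ᶠ x in 𝓝 s, 0 < R w - r.1 w * x := by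
          have hc : ContinuousAt (fun x => R w - r.1 w * x) s := by fun_prop
          exact hc.eventually (lt_mem_nhds (by linarith : 0 < R w - r.1 w * s))
        filter_upwards [this] with x hx using max_eq_left hx.le
    have h2 := (HasDerivWithinAt.fun_sum (fun w (_ : w ∈ Finset.univ) => h1 w)).fun_neg.exp
    have h3 := ((hasDerivAt_id s).neg.exp.hasDerivWithinAt (s := Ioi s)).mul h2
    refine h3.congr_deriv ?_
    have h4 : ∑ w, (if R w ≤ r.1 w * s then 0 else - r.1 w) =
        (∑ z, if R z ≤ r.1 z * s then r.1 z else 0) - 1 := by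
      rw [← hr1, ← Finset.sum_sub_distrib]
      refine Finset.sum_congr rfl fun w _ => ?_
      split_ifs <;> ring
    rw [h4]
    simp only [hf', hE, id, Pi.neg_apply]
    ring
  have hbound : ∀ s, |f' s| ≤ Real.exp (-s) := by
    intro s
    have h1 : 0 ≤ ∑ z, (if R z ≤ r.1 z * s then r.1 z else 0) :=
      Finset.sum_nonneg fun z _ => by split_ifs <;> simp [hr0]
    have h2 : ∑ z, (if R z ≤ r.1 z * s then r.1 z else 0) ≤ 1 := by
      rw [← hr1]
      exact Finset.sum_le_sum fun z _ => by split_ifs <;> simp [hr0]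
    have h3 : Real.exp (-∑ w, max (R w - r.1 w * s) 0) ≤ 1 := by
      rw [Real.exp_le_one_iff, neg_nonpos]
      exact Finset.sum_nonneg fun w _ => le_max_right _ _
    rw [hf', abs_neg, abs_of_nonneg (mul_nonneg (by positivity) h1)]
    calc E s * _ ≤ (Real.exp (-s) * 1) * 1 := by
          apply mul_le_mul _ h2 h1 (by positivity)
          exact mul_le_mul_of_nonneg_left h3 (by positivity)
      _ = _ := by ring
  have hmeas : Measurable f' := by
    refine (hEc.measurable.mul (Finset.measurable_sum _ fun z _ => ?_)).neg
    exact Measurable.ite (measurableSet_le measurable_const (by fun_prop)) measurable_const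
      measurable_const
  have hint : IntegrableOn f' (Ioi 0) := by
    exact Integrable.mono' (integrableOn_exp_neg_Ioi 0) hmeas.aestronglyMeasurable
      (Eventually.of_forall fun s => hbound s)
  have hFTC : ∀ b : ℝ, 0 ≤ b → ∫ s in (0 : ℝ)..b, f' s = E b - E 0 := by
    intro b hb
    refine intervalIntegral.integral_eq_sub_of_hasDeriv_right hEc.continuousOn
      (fun x _ => hderiv x) ?_
    rw [intervalIntegrable_iff_integrableOn_Ioc_of_le hb]
    exact hint.mono_set Ioc_subset_Ioi_self
  have hlim : Tendsto E atTop (𝓝 0) := by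
    refine squeeze_zero (fun s => by positivity) (fun s => ?_)
      (Real.tendsto_exp_atBot.comp tendsto_neg_atTop_atBot)
    simp only [hE, Function.comp]
    refine mul_le_of_le_one_right (by positivity) ?_
    rw [Real.exp_le_one_iff, neg_nonpos]
    exact Finset.sum_nonneg fun w _ => le_max_right _ _
  have hI : ∫ s in Ioi (0 : ℝ), f' s = - E 0 := by
    refine tendsto_nhds_unique (intervalIntegral_tendsto_integral_Ioi 0 hint tendsto_id) ?_
    have : Tendsto (fun b => E b - E 0) atTop (𝓝 (0 - E 0)) := hlim.sub_const _
    rw [zero_sub] at this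
    refine this.congr' ?_
    filter_upwards [eventually_ge_atTop 0] with b hb using (hFTC b hb).symm
  have hmz : ∀ z, Measurable fun s : ℝ => (if R z ≤ r.1 z * s then
        ENNReal.ofReal (Real.exp (-∑ w, max (R w - r.1 w * s) 0)) else 0) := fun z =>
    Measurable.ite (measurableSet_le measurable_const (by fun_prop)) (by fun_prop)
      measurable_const
  calc _ = ∑ z, ∫⁻ s in Ioi (0 : ℝ), ENNReal.ofReal (r.1 z) * (ENNReal.ofReal (Real.exp (-s)) *
        (if R z ≤ r.1 z * s then
        ENNReal.ofReal (Real.exp (-∑ w, max (R w - r.1 w * s) 0)) else 0)) := by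
        refine Finset.sum_congr rfl fun z _ => ?_
        rw [lintegral_expMeasure_one (hmz z), ← lintegral_const_mul]
        exact (by fun_prop : Measurable fun s : ℝ => ENNReal.ofReal (Real.exp (-s))).mul (hmz z)
    _ = ∫⁻ s in Ioi (0 : ℝ), ENNReal.ofReal (- f' s) := by
        rw [← lintegral_finsetSum]
        · refine lintegral_congr fun s => ?_
          rw [hf', neg_neg, Finset.mul_sum, ENNReal.ofReal_sum_of_nonneg]
          · refine Finset.sum_congr rfl fun z _ => ?_
            split_ifs
            · rw [← ENNReal.ofReal_mul (by positivity), ← ENNReal.ofReal_mul (hr0 z), mul_comm]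
            · simp
          · intro z _
            split_ifs <;> [exact mul_nonneg (by positivity) (hr0 z); simp]
        · intro z _
          exact ((by fun_prop : Measurable fun s : ℝ => ENNReal.ofReal (Real.exp (-s))).mul
            (hmz z)).const_mul _
    _ = _ := by
        rw [← ofReal_integral_eq_lintegral_ofReal (f := fun s => -f' s) hint.neg, integral_neg, hI, neg_neg]
        · simp [hE]
        · refine Eventually.of_forall fun s => ?_
          simp only [hf', Pi.zero_apply, neg_neg]
          exact mul_nonneg (by positivity)
            (Finset.sum_nonneg fun z _ => by split_ifs <;> simp [hr0])

end

/-! ### The marked chain and its law -/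

section

variable {S : Type*} [Fintype S]

/-- The jump probabilities used at step `i`: the initial distribution for `i = 0`, and the row of
the transition matrix at the previous state afterwards. -/
def rate (ν : stdSimplex ℝ S) (P : S → stdSimplex ℝ S) (ω : ℕ → S × ℝ) : ℕ → stdSimplex ℝ S
  | 0 => ν
  | i + 1 => P (ω i).1

lemma rate_congr (ν : stdSimplex ℝ S) (P : S → stdSimplex ℝ S) {ω ω' : ℕ → S × ℝ} {n : ℕ} (h : ∀ i < n, ω i = ω' i) {i : ℕ} (hi : i ≤ n) :
    rate ν P ω i = rate ν P ω' i := by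
  cases i with
  | zero => rfl
  | succ i => simp [rate, h i hi]

variable [MeasurableSpace S]

/-- The law of one step of the marked chain: a state with distribution `r` together with an
independent standard exponential holding time. -/
def markLaw (r : stdSimplex ℝ S) : Measure (S × ℝ) :=
  (∑ z, ENNReal.ofReal (r.1 z) • Measure.dirac z).prod (expMeasure 1)

instance (r : stdSimplex ℝ S) : IsProbabilityMeasure (markLaw r) := by
  have h : IsProbabilityMeasure (∑ z, ENNReal.ofReal (r.1 z) • Measure.dirac z) := by
    constructor
    simp only [Measure.coe_finsetSum, Finset.sum_apply, Measure.smul_apply, measure_univ,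
      smul_eq_mul, mul_one]
    rw [← ENNReal.ofReal_sum_of_nonneg fun z _ => r.2.1 z, r.2.2, ENNReal.ofReal_one]
  unfold markLaw
  infer_instance

lemma lintegral_markLaw (r : stdSimplex ℝ S) {f : S × ℝ → ℝ≥0∞} (hf : Measurable f) :
    ∫⁻ w, f w ∂markLaw r = ∑ z, ENNReal.ofReal (r.1 z) * ∫⁻ s, f (z, s) ∂expMeasure 1 := by
  have h : SFinite (∑ z, ENNReal.ofReal (r.1 z) • Measure.dirac z : Measure S) := by
    rw [← Measure.sum_fintype]
    infer_instance
  rw [markLaw, lintegral_prod _ hf.aemeasurable, lintegral_finsetSum_measure]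
  refine Finset.sum_congr rfl fun z _ => ?_
  rw [lintegral_smul_measure, lintegral_dirac' _ hf.lintegral_prod_right', smul_eq_mul]

variable [DiscreteMeasurableSpace S]

/-- The transition kernel of the marked chain with transition probabilities `P`, as a kernel from
trajectories up to time `n`. -/
def markKernel (P : S → stdSimplex ℝ S) (n : ℕ) :
    Kernel ((i : Finset.Iic n) → (fun _ : ℕ => S × ℝ) i) (S × ℝ) :=
  (Kernel.ofFunOfCountable fun x => markLaw (P x)).comap
    (fun h => (h ⟨n, by simp⟩).1) (by fun_prop)

instance (P : S → stdSimplex ℝ S) (n : ℕ) : IsMarkovKernel (markKernel P n) := by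
  have : IsMarkovKernel (Kernel.ofFunOfCountable fun x => markLaw (P x)) :=
    ⟨fun x => inferInstanceAs (IsProbabilityMeasure (markLaw (P x)))⟩
  unfold markKernel
  infer_instance

/-- The law of the marked chain: the states form a Markov chain with initial distribution `ν` and
transition probabilities `P`, and the marks are independent standard exponential times. -/
def pathLaw (ν : stdSimplex ℝ S) (P : S → stdSimplex ℝ S) : Measure (ℕ → S × ℝ) :=
  Kernel.trajMeasure (X := fun _ => S × ℝ) (markLaw ν) (markKernel P)

instance (ν : stdSimplex ℝ S) (P : S → stdSimplex ℝ S) : IsProbabilityMeasure (pathLaw ν P) := by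
  unfold pathLaw
  infer_instance

variable (ν : stdSimplex ℝ S) (P : S → stdSimplex ℝ S)

lemma pathLaw_map_zero : (pathLaw ν P).map (fun ω => ω 0) = markLaw ν := by
  let ev : ((i : Finset.Iic 0) → (fun _ : ℕ => S × ℝ) i) → S × ℝ := fun h => h ⟨0, by simp⟩
  have hev : Measurable ev := by fun_prop
  have h1 : (fun ω : ℕ → S × ℝ => ω 0) =
      ev ∘ Preorder.frestrictLe (π := fun _ => S × ℝ) 0 := rfl
  rw [h1, ← Measure.map_map hev (by fun_prop), pathLaw, Kernel.trajMeasure,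
    Measure.map_comp _ _ (by fun_prop), Kernel.traj_map_frestrictLe, Kernel.partialTraj_self,
    Measure.id_comp, Measure.map_map hev (by fun_prop)]
  exact Measure.map_id

lemma lintegral_pathLaw_zero {f : S × ℝ → ℝ≥0∞} (hf : Measurable f) :
    ∫⁻ ω, f (ω 0) ∂pathLaw ν P = ∫⁻ w, f w ∂markLaw ν := by
  rw [← pathLaw_map_zero ν P, lintegral_map hf (by fun_prop)]

/-- The Markov property of the marked chain, at the level of integrals: the step after time `n`
can be integrated out first. -/
lemma lintegral_pathLaw_succ (n : ℕ) {F : (ℕ → S × ℝ) → S × ℝ → ℝ≥0∞}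
    (hF : Measurable (Function.uncurry F))
    (hdep : ∀ ω ω' : ℕ → S × ℝ, (∀ i ≤ n, ω i = ω' i) → F ω = F ω') :
    ∫⁻ ω, F ω (ω (n + 1)) ∂pathLaw ν P =
      ∫⁻ ω, ∫⁻ w, F ω w ∂markLaw (P (ω n).1) ∂pathLaw ν P := by
  let e : ((i : Finset.Iic n) → S × ℝ) → ℕ → S × ℝ := fun h i =>
    if hi : i ≤ n then h ⟨i, by simpa using hi⟩ else h ⟨n, by simp⟩
  have he : Measurable e := by
    refine measurable_pi_lambda _ fun i => ?_
    by_cases hi : i ≤ n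
    · simp only [e, hi, dite_true]; fun_prop
    · simp only [e, hi, dite_false]; fun_prop
  have hFe : ∀ ω, F (e (Preorder.frestrictLe n ω)) = F ω := fun ω =>
    hdep _ _ fun i hi => by simp [e, hi]
  have hG : Measurable fun p : ((i : Finset.Iic n) → S × ℝ) × (S × ℝ) => F (e p.1) p.2 :=
    hF.comp ((he.comp measurable_fst).prodMk measurable_snd)
  have key := Kernel.map_frestrictLe_trajMeasure_compProd_eq_map_trajMeasure
    (X := fun _ => S × ℝ) (μ₀ := markLaw ν) (κ := markKernel P) (a := n)
  have h1 : ∫⁻ ω, F ω (ω (n + 1)) ∂pathLaw ν P =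
      ∫⁻ p, F (e p.1) p.2 ∂(Kernel.trajMeasure (X := fun _ => S × ℝ) (markLaw ν)
        (markKernel P)).map (fun x => (Preorder.frestrictLe n x, x (n + 1))) := by
    rw [lintegral_map hG (by fun_prop)]
    simp only [hFe]
    rfl
  rw [h1, ← key, Measure.lintegral_compProd hG, lintegral_map _ (by fun_prop)]
  · simp only [hFe]
    rfl
  · exact hG.lintegral_kernel_prod_right'

lemma measurable_rate (i : ℕ) (z : S) : Measurable fun ω => (rate ν P ω i).1 z := by
  cases i with
  | zero => exact measurable_const (a := ν.1 z)
  | succ i =>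
    exact (Measurable.of_discrete (f := fun x => (P x).1 z)).comp (by fun_prop)

/-- Uniform version of `lintegral_pathLaw_zero` and `lintegral_pathLaw_succ`. -/
lemma lintegral_pathLaw_step (n : ℕ) {F : (ℕ → S × ℝ) → S × ℝ → ℝ≥0∞}
    (hF : Measurable (Function.uncurry F))
    (hdep : ∀ ω ω' : ℕ → S × ℝ, (∀ i < n, ω i = ω' i) → F ω = F ω') :
    ∫⁻ ω, F ω (ω n) ∂pathLaw ν P =
      ∫⁻ ω, ∫⁻ w, F ω w ∂markLaw (rate ν P ω n) ∂pathLaw ν P := by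
  cases n with
  | zero =>
    have ω₀ : ℕ → S × ℝ := (nonempty_of_isProbabilityMeasure (pathLaw ν P)).some
    have h : ∀ ω, F ω = F ω₀ := fun ω => hdep _ _ (by simp)
    simp only [h, rate]
    rw [lintegral_pathLaw_zero ν P (f := F ω₀) (hF.comp measurable_prodMk_left)]
    simp
  | succ n =>
    exact lintegral_pathLaw_succ ν P n hF fun ω ω' h => hdep _ _ fun i hi => h i (by omega)

end

/-! ### Soft local times and the levels of first visits -/

section

section Definitions

variable {S : Type*} [Fintype S]

/-- The soft local time at `z` accumulated over the first `n` steps. -/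
def softTime (ν : stdSimplex ℝ S) (P : S → stdSimplex ℝ S) (n : ℕ) (ω : ℕ → S × ℝ) (z : S) : ℝ :=
  ∑ i ∈ Finset.range n, (ω i).2 * (rate ν P ω i).1 z

open Classical in
/-- The soft local time at `z` accumulated up to and including the step of the first visit to `z`
(over all steps, if `z` is never visited). -/
def firstLevel (ν : stdSimplex ℝ S) (P : S → stdSimplex ℝ S) (ω : ℕ → S × ℝ) (z : S) : ℝ≥0∞ :=
  ∑' i, if ∀ j < i, (ω j).1 ≠ z then ENNReal.ofReal ((ω i).2 * (rate ν P ω i).1 z) else 0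

/-- Each visit during the first `n` steps happens when the soft local time of the visited state
has reached its threshold `t`. -/
def Respects (ν : stdSimplex ℝ S) (P : S → stdSimplex ℝ S) (t : S → ℝ) (n : ℕ)
    (ω : ℕ → S × ℝ) : Prop :=
  ∀ z, ∀ i < n, (ω i).1 = z → t z ≤ softTime ν P (i + 1) ω z

open Classical in
/-- The conditional probability, given the first `n` steps, that all first visits respect the
thresholds `t`. -/
def respectsMartingale (ν : stdSimplex ℝ S) (P : S → stdSimplex ℝ S) (t : S → ℝ) (n : ℕ)
    (ω : ℕ → S × ℝ) : ℝ≥0∞ :=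
  if Respects ν P t n ω then
    ENNReal.ofReal (Real.exp (-∑ w, max (t w - softTime ν P n ω w) 0)) else 0

variable (ν : stdSimplex ℝ S) (P : S → stdSimplex ℝ S)

lemma softTime_congr {ω ω' : ℕ → S × ℝ} {n : ℕ} (h : ∀ i < n, ω i = ω' i) {k : ℕ} (hk : k ≤ n)
    (z : S) : softTime ν P k ω z = softTime ν P k ω' z := by
  refine Finset.sum_congr rfl fun i hi => ?_
  have hi : i < n := (Finset.mem_range.1 hi).trans_le hk
  rw [h i hi, rate_congr ν P h hi.le]

lemma softTime_succ (n : ℕ) (ω : ℕ → S × ℝ) (z : S) :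
    softTime ν P (n + 1) ω z = softTime ν P n ω z + (ω n).2 * (rate ν P ω n).1 z :=
  Finset.sum_range_succ _ _

lemma respects_congr (t : S → ℝ) {ω ω' : ℕ → S × ℝ} {n : ℕ} (h : ∀ i < n, ω i = ω' i) :
    Respects ν P t n ω ↔ Respects ν P t n ω' := by
  refine forall_congr' fun z => forall_congr' fun i => ?_
  refine forall_congr' fun hi => ?_
  rw [h i hi, softTime_congr ν P h hi z]

lemma respects_succ (t : S → ℝ) (n : ℕ) (ω : ℕ → S × ℝ) :
    Respects ν P t (n + 1) ω ↔ Respects ν P t n ω ∧ t (ω n).1 ≤ softTime ν P (n + 1) ω (ω n).1 := by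
  constructor
  · exact fun h => ⟨fun z i hi => h z i (by omega), h _ n (by omega) rfl⟩
  · rintro ⟨h1, h2⟩ z i hi rfl
    rcases Nat.lt_succ_iff_lt_or_eq.1 hi with h | rfl
    · exact h1 _ i h rfl
    · exact h2

variable {ν P} {ω : ℕ → S × ℝ}

lemma softTime_term_nonneg (hω : ∀ i, 0 < (ω i).2) (i : ℕ) (z : S) : 0 ≤ (ω i).2 * (rate ν P ω i).1 z :=
  mul_nonneg (hω i).le ((rate ν P ω i).2.1 z)

lemma softTime_mono (hω : ∀ i, 0 < (ω i).2) {m n : ℕ} (h : m ≤ n) (z : S) :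
    softTime ν P m ω z ≤ softTime ν P n ω z :=
  Finset.sum_le_sum_of_subset_of_nonneg (Finset.range_mono h)
    fun i _ _ => softTime_term_nonneg hω i z

lemma softTime_nonneg (hω : ∀ i, 0 < (ω i).2) (n : ℕ) (z : S) : 0 ≤ softTime ν P n ω z :=
  Finset.sum_nonneg fun i _ => softTime_term_nonneg hω i z

lemma firstLevel_le_softTime (hω : ∀ i, 0 < (ω i).2) {i : ℕ} {z : S} (h : (ω i).1 = z) :
    firstLevel ν P ω z ≤ ENNReal.ofReal (softTime ν P (i + 1) ω z) := by
  classical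
  rw [firstLevel, tsum_eq_sum (s := Finset.range (i + 1)), softTime,
    ENNReal.ofReal_sum_of_nonneg fun k _ => softTime_term_nonneg hω k z]
  · exact Finset.sum_le_sum fun k _ => by split_ifs <;> simp
  · intro k hk
    refine if_neg fun hk' => hk' i ?_ h
    simp only [Finset.mem_range] at hk
    omega

lemma softTime_le_firstLevel (hω : ∀ i, 0 < (ω i).2) {n : ℕ} {z : S} (h : ∀ j < n, (ω j).1 ≠ z) :
    ENNReal.ofReal (softTime ν P (n + 1) ω z) ≤ firstLevel ν P ω z := by
  classical
  rw [firstLevel, softTime, ENNReal.ofReal_sum_of_nonneg fun k _ => softTime_term_nonneg hω k z]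
  refine le_trans (Finset.sum_le_sum fun k hk => ?_) (ENNReal.sum_le_tsum (Finset.range (n + 1)))
  have hk : k < n + 1 := Finset.mem_range.1 hk
  rw [if_pos fun j hj => h j (by omega)]

/-- When every state is visited, respecting the thresholds forever means that they do not exceed
the levels of the first visits. -/
lemma forall_respects_iff (hω : ∀ i, 0 < (ω i).2) (hv : ∀ z, ∃ i, (ω i).1 = z) (t : S → ℝ) :
    (∀ n, Respects ν P t n ω) ↔ ∀ z, t z ≤ (firstLevel ν P ω z).toReal := by
  classical
  have hfin : ∀ z, firstLevel ν P ω z ≠ ∞ := fun z =>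
    ne_top_of_le_ne_top ENNReal.ofReal_ne_top (firstLevel_le_softTime hω (hv z).choose_spec)
  constructor
  · intro h z
    have h1 := h (Nat.find (hv z) + 1) z (Nat.find (hv z)) (by omega) (Nat.find_spec (hv z))
    have h2 := softTime_le_firstLevel (ν := ν) (P := P) hω (z := z)
      fun j hj => Nat.find_min (hv z) hj
    exact h1.trans ((ENNReal.ofReal_le_iff_le_toReal (hfin z)).1 h2)
  · intro h n z i _ hiz
    refine (h z).trans ?_
    have := ENNReal.toReal_mono ENNReal.ofReal_ne_top
      (firstLevel_le_softTime (ν := ν) (P := P) hω hiz)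
    rwa [ENNReal.toReal_ofReal (softTime_nonneg hω _ z)] at this

lemma tendsto_respectsMartingale (hω : ∀ i, 0 < (ω i).2) (hv : ∀ z, ∃ i, (ω i).1 = z) (t : S → ℝ) :
    Tendsto (fun n => respectsMartingale ν P t n ω) atTop
      (𝓝 ({ω | ∀ n, Respects ν P t n ω}.indicator 1 ω)) := by
  classical
  refine tendsto_const_nhds.congr' ?_
  by_cases h : ∀ n, Respects ν P t n ω
  · choose i hi using hv
    filter_upwards [eventually_gt_atTop (Finset.univ.sup i)] with n hn
    have h0 : ∀ w, max (t w - softTime ν P n ω w) 0 = 0 := by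
      intro w
      have h1 : i w < n := (Finset.le_sup (f := i) (Finset.mem_univ w)).trans_lt hn
      have h2 := h n w (i w) h1 (hi w)
      have h3 := softTime_mono (ν := ν) (P := P) hω (Nat.succ_le_of_lt h1) w
      exact max_eq_right (by linarith)
    simp [respectsMartingale, h, h0]
  · have h' := h
    push Not at h
    obtain ⟨m, hm⟩ := h
    filter_upwards [eventually_ge_atTop m] with n hn
    have : ¬ Respects ν P t n ω := fun hn' => hm fun z k hk => hn' z k (by omega)
    rw [respectsMartingale, if_neg this, indicator_of_notMem (by exact h')]

end Definitions

variable {S : Type*} [Fintype S] [MeasurableSpace S] [DiscreteMeasurableSpace S]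
variable (ν : stdSimplex ℝ S) (P : S → stdSimplex ℝ S)

lemma measurable_softTime (n : ℕ) (z : S) : Measurable fun ω => softTime ν P n ω z :=
  Finset.measurable_sum _ fun i _ =>
    (measurable_snd.comp (measurable_pi_apply i)).mul (measurable_rate ν P i z)

lemma measurable_state_eq (i : ℕ) (z : S) :
    Measurable fun ω : ℕ → S × ℝ => (ω i).1 = z :=
  measurableSet_setOfPred.1 ((measurable_fst.comp (measurable_pi_apply i)) (MeasurableSet.singleton z))

lemma measurable_respects (t : S → ℝ) (n : ℕ) : Measurable (Respects ν P t n) := by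
  refine Measurable.forall fun z => Measurable.forall fun i => measurable_const.imp ?_
  refine (measurable_state_eq i z).imp ?_
  exact measurableSet_setOfPred.1 (measurableSet_le measurable_const (measurable_softTime ν P _ z))

lemma measurable_respectsMartingale (t : S → ℝ) (n : ℕ) :
    Measurable (respectsMartingale ν P t n) := by
  refine Measurable.ite (measurableSet_setOfPred.2 (measurable_respects ν P t n)) ?_ measurable_const
  have := measurable_softTime ν P n
  fun_prop

lemma measurable_firstLevel : Measurable (firstLevel ν P) := by
  refine measurable_pi_lambda _ fun z => Measurable.tsum fun i => ?_
  refine Measurable.ite ?_ ?_ measurable_const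
  · refine measurableSet_setOfPred.2 (Measurable.forall fun j => measurable_const.imp ?_)
    exact (measurable_state_eq j z).not
  · exact ((measurable_snd.comp (measurable_pi_apply i)).mul (measurable_rate ν P i z)).ennreal_ofReal

lemma ae_hold_pos : ∀ᵐ ω ∂pathLaw ν P, ∀ i, 0 < (ω i).2 := by
  rw [ae_all_iff]
  intro i
  have hm : MeasurableSet {w : S × ℝ | ¬ 0 < w.2} := (measurableSet_Ioi.preimage measurable_snd).compl
  have hm' : MeasurableSet {ω : ℕ → S × ℝ | ¬ 0 < (ω i).2} := hm.preimage (measurable_pi_apply i)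
  rw [ae_iff, ← lintegral_indicator_one hm']
  have h := lintegral_pathLaw_step ν P i
    (F := fun _ w => {w : S × ℝ | ¬ 0 < w.2}.indicator 1 w)
    ((measurable_one.indicator hm).comp measurable_snd) (fun _ _ _ => rfl)
  refine (Eq.trans ?_ h).trans ?_
  · rfl
  · refine (lintegral_congr fun ω => ?_).trans lintegral_zero
    rw [lintegral_markLaw _ (measurable_one.indicator hm)]
    refine Finset.sum_eq_zero fun z _ => ?_
    have : ∫⁻ s, {w : S × ℝ | ¬ 0 < w.2}.indicator 1 (z, s) ∂expMeasure 1 = 0 := by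
      rw [lintegral_eq_zero_iff
        (f := fun s => {w : S × ℝ | ¬ 0 < w.2}.indicator (1 : S × ℝ → ℝ≥0∞) (z, s))
        ((measurable_one.indicator hm).comp measurable_prodMk_left)]
      filter_upwards [ae_pos_expMeasure_one] with s hs
      simp [hs]
    rw [this, mul_zero]

lemma lintegral_respectsMartingale (t : S → ℝ) (n : ℕ) :
    ∫⁻ ω, respectsMartingale ν P t n ω ∂pathLaw ν P =
      ENNReal.ofReal (Real.exp (-∑ w, max (t w) 0)) := by
  classical
  induction n with
  | zero => simp [respectsMartingale, Respects, softTime]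
  | succ n ih =>
    rw [← ih]
    set F : (ℕ → S × ℝ) → S × ℝ → ℝ≥0∞ := fun ω w =>
      if Respects ν P t n ω ∧
          t w.1 - softTime ν P n ω w.1 ≤ (rate ν P ω n).1 w.1 * w.2 then
        ENNReal.ofReal (Real.exp (-∑ x, max (t x - softTime ν P n ω x -
          (rate ν P ω n).1 x * w.2) 0)) else 0 with hF
    have hms : ∀ z, Measurable fun p : (ℕ → S × ℝ) × (S × ℝ) => softTime ν P n p.1 z := fun z =>
      (measurable_softTime ν P n z).comp measurable_fst
    have hmr : ∀ z, Measurable fun p : (ℕ → S × ℝ) × (S × ℝ) => (rate ν P p.1 n).1 z := fun z =>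
      (measurable_rate ν P n z).comp measurable_fst
    have hFm : Measurable (Function.uncurry F) := by
      refine Measurable.ite ?_ ?_ measurable_const
      · refine MeasurableSet.inter
          (measurableSet_setOfPred.2 ((measurable_respects ν P t n).comp measurable_fst)) ?_
        have : {p : (ℕ → S × ℝ) × (S × ℝ) | t p.2.1 - softTime ν P n p.1 p.2.1 ≤
            (rate ν P p.1 n).1 p.2.1 * p.2.2} = ⋃ z, ({p | p.2.1 = z} ∩
            {p | t z - softTime ν P n p.1 z ≤ (rate ν P p.1 n).1 z * p.2.2}) := by
          ext p; simp
        refine MeasurableSet.congr ?_ this.symm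
        refine MeasurableSet.iUnion fun z => MeasurableSet.inter ?_ ?_
        · exact (measurable_fst.comp measurable_snd) (MeasurableSet.singleton z)
        · exact measurableSet_le (by fun_prop) (by fun_prop)
      · fun_prop
    have hFd : ∀ ω ω' : ℕ → S × ℝ, (∀ i < n, ω i = ω' i) → F ω = F ω' := by
      intro ω ω' h
      funext w
      simp only [hF, respects_congr ν P t h, rate_congr ν P h le_rfl,
        softTime_congr ν P h le_rfl]
    have h1 : ∀ ω, respectsMartingale ν P t (n + 1) ω = F ω (ω n) := by
      intro ω
      simp only [respectsMartingale, hF, respects_succ, softTime_succ, sub_le_iff_le_add',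
        mul_comm ((rate ν P ω n).1 _), sub_sub]
    simp_rw [h1]
    rw [lintegral_pathLaw_step ν P n hFm hFd]
    refine lintegral_congr fun ω => ?_
    rw [lintegral_markLaw _ (f := F ω) (hFm.comp measurable_prodMk_left), respectsMartingale]
    split_ifs with h
    · rw [← lintegral_competing_clocks (rate ν P ω n) fun w => t w - softTime ν P n ω w]
      simp only [hF, h, true_and]
    · simp [hF, h]

/-- The levels of the first visits are independent standard exponential variables, whatever the
chain, as soon as all states are visited. -/
lemma map_firstLevel_eq_pi (hv : ∀ᵐ ω ∂pathLaw ν P, ∀ z, ∃ i, (ω i).1 = z) :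
    (pathLaw ν P).map (fun ω z => (firstLevel ν P ω z).toReal) =
      Measure.pi fun _ : S => expMeasure 1 := by
  have hmeas : Measurable fun ω z => (firstLevel ν P ω z).toReal :=
    measurable_pi_lambda _ fun z =>
      ((measurable_pi_apply z).comp (measurable_firstLevel ν P)).ennreal_toReal
  have hbox : ∀ t : S → ℝ, pathLaw ν P {ω | ∀ z, t z ≤ (firstLevel ν P ω z).toReal} =
      ENNReal.ofReal (Real.exp (-∑ w, max (t w) 0)) := by
    intro t
    have hm : MeasurableSet {ω | ∀ n, Respects ν P t n ω} :=
      measurableSet_setOfPred.2 (Measurable.forall fun n => measurable_respects ν P t n)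
    have h1 : pathLaw ν P {ω | ∀ z, t z ≤ (firstLevel ν P ω z).toReal} =
        pathLaw ν P {ω | ∀ n, Respects ν P t n ω} := by
      refine measure_congr ?_
      filter_upwards [hv, ae_hold_pos ν P] with ω h1 h2
      exact propext (forall_respects_iff h2 h1 t).symm
    rw [h1, ← lintegral_indicator_one hm]
    refine tendsto_nhds_unique (tendsto_lintegral_of_dominated_convergence
      (F := fun n => respectsMartingale ν P t n) (fun _ => 1)
      (measurable_respectsMartingale ν P t) (fun n => Eventually.of_forall fun ω => ?_)
      (by simp) ?_) ?_
    · rw [respectsMartingale]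
      split_ifs
      · rw [ENNReal.ofReal_le_one, Real.exp_le_one_iff, neg_nonpos]
        exact Finset.sum_nonneg fun w _ => le_max_right _ _
      · exact zero_le_one
    · filter_upwards [hv, ae_hold_pos ν P] with ω h1 h2
      exact tendsto_respectsMartingale h2 h1 t
    · simp_rw [lintegral_respectsMartingale]
      exact tendsto_const_nhds
  symm
  refine Measure.pi_eq_generateFrom (C := fun _ => range Ici)
    (fun _ => (borel_eq_generateFrom_Ici ℝ).symm.trans (BorelSpace.measurable_eq).symm)
    (fun _ => isPiSystem_Ici) (fun _ => ?_) ?_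
  · refine ⟨fun n => Ici (-n : ℝ), fun n => ⟨_, rfl⟩, fun n => measure_lt_top _ _, ?_⟩
    refine eq_univ_of_forall fun x => ?_
    obtain ⟨n, hn⟩ := exists_nat_ge (-x)
    exact mem_iUnion.2 ⟨n, mem_Ici.2 (by linarith)⟩
  · intro s hs
    choose t ht using hs
    obtain rfl : s = fun z => Ici (t z) := funext fun z => (ht z).symm
    rw [Measure.map_apply hmeas (MeasurableSet.univ_pi fun _ => measurableSet_Ici)]
    have : (fun ω z => (firstLevel ν P ω z).toReal) ⁻¹' (univ.pi fun z => Ici (t z)) =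
        {ω | ∀ z, t z ≤ (firstLevel ν P ω z).toReal} := by
      ext ω; simp [Pi.le_def]
    rw [this, hbox t, ← Finset.sum_neg_distrib, Real.exp_sum,
      ENNReal.ofReal_prod_of_nonneg fun _ _ => (Real.exp_pos _).le]
    exact Finset.prod_congr rfl fun z _ => (expMeasure_one_Ici _).symm

end

/-! ### Markov property and arithmetic progressions of times -/

section

section Operator

variable {S : Type*} [Fintype S]

/-- The action of the transition probabilities `P` on nonnegative functions. -/
def transOp (P : S → stdSimplex ℝ S) (v : S → ℝ≥0∞) (x : S) : ℝ≥0∞ :=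
  ∑ y, ENNReal.ofReal ((P x).1 y) * v y

lemma iterate_transOp [DecidableEq S] (P : S → stdSimplex ℝ S) {M : Matrix S S ℝ}
    (hM : ∀ x y, M x y = (P x).1 y) (m : ℕ) (v : S → ℝ≥0∞) (x : S) :
    (transOp P)^[m] v x = ∑ y, ENNReal.ofReal ((M ^ m) x y) * v y := by
  have hM0 : ∀ x y, 0 ≤ M x y := fun x y => (hM x y).symm ▸ (P x).2.1 y
  have hnn : ∀ (m : ℕ) (x y : S), 0 ≤ (M ^ m) x y := by
    intro m
    induction m with
    | zero => intro x y; rw [pow_zero, Matrix.one_apply]; split_ifs <;> simp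
    | succ m ih =>
      intro x y
      rw [pow_succ, Matrix.mul_apply]
      exact Finset.sum_nonneg fun z _ => mul_nonneg (ih x z) (hM0 z y)
  induction m generalizing v with
  | zero => simp [Matrix.one_apply, apply_ite ENNReal.ofReal, ite_mul]
  | succ m ih =>
    rw [Function.iterate_succ_apply, ih]
    simp only [transOp, Finset.mul_sum]
    rw [Finset.sum_comm]
    refine Finset.sum_congr rfl fun y _ => ?_
    rw [pow_succ, Matrix.mul_apply, ENNReal.ofReal_sum_of_nonneg
      fun z _ => mul_nonneg (hnn m x z) (hM0 z y), Finset.sum_mul]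
    refine Finset.sum_congr rfl fun z _ => ?_
    rw [ENNReal.ofReal_mul (hnn m x z), mul_assoc, hM]

end Operator

lemma measurable_state_comp {S : Type*} [MeasurableSpace S] [DiscreteMeasurableSpace S]
    (v : S → ℝ≥0∞) (i : ℕ) : Measurable fun ω : ℕ → S × ℝ => v (ω i).1 :=
  (Measurable.of_discrete (f := v)).comp (measurable_fst.comp (measurable_pi_apply i))

variable {S : Type*} [Fintype S] [MeasurableSpace S] [DiscreteMeasurableSpace S]
variable (ν : stdSimplex ℝ S) (P : S → stdSimplex ℝ S)

/-- Integrating out the last step when the integrand is a product of a function of the past, a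
function of the new state and a function of the new holding time. -/
lemma lintegral_pathLaw_mul (n : ℕ) {A : (ℕ → S × ℝ) → ℝ≥0∞} (hA : Measurable A)
    (hdep : ∀ ω ω' : ℕ → S × ℝ, (∀ i < n, ω i = ω' i) → A ω = A ω') (v : S → ℝ≥0∞) :
    ∫⁻ ω, A ω * v (ω n).1 ∂pathLaw ν P =
      ∫⁻ ω, A ω * ∑ z, ENNReal.ofReal ((rate ν P ω n).1 z) * v z ∂pathLaw ν P := by
  have hv : Measurable fun w : S × ℝ => v w.1 := (Measurable.of_discrete (f := v)).comp measurable_fst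
  rw [lintegral_pathLaw_step ν P n (F := fun ω w => A ω * v w.1)
    ((hA.comp measurable_fst).mul (hv.comp measurable_snd))
    (fun ω ω' h => by rw [hdep ω ω' h])]
  refine lintegral_congr fun ω => ?_
  rw [lintegral_const_mul _ hv, lintegral_markLaw _ hv]
  simp

lemma lintegral_pathLaw_mul_iterate (m n : ℕ) {A : (ℕ → S × ℝ) → ℝ≥0∞} (hA : Measurable A)
    (hdep : ∀ ω ω' : ℕ → S × ℝ, (∀ i ≤ n, ω i = ω' i) → A ω = A ω') (v : S → ℝ≥0∞) :
    ∫⁻ ω, A ω * v (ω (n + m)).1 ∂pathLaw ν P =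
      ∫⁻ ω, A ω * (transOp P)^[m] v (ω n).1 ∂pathLaw ν P := by
  induction m generalizing v with
  | zero => rfl
  | succ m ih =>
    rw [← add_assoc, lintegral_pathLaw_mul ν P (n + m + 1) hA
      (fun ω ω' h => hdep ω ω' fun i hi => h i (by omega)), Function.iterate_succ_apply, ← ih]
    rfl

/-- Along an arithmetic progression of times with difference `m`, exponential moments multiply. -/
lemma lintegral_prod_le_pow (m j L : ℕ) {f : S → ℝ≥0∞} {K : ℝ≥0∞}
    (hK : ∀ x, (transOp P)^[m] f x ≤ K) :
    ∫⁻ ω, ∏ l ∈ Finset.range L, f (ω (j + m * (l + 1))).1 ∂pathLaw ν P ≤ K ^ L := by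
  induction L with
  | zero => simp
  | succ L ih =>
    simp_rw [Finset.prod_range_succ, mul_add_one m L, ← add_assoc]
    rw [lintegral_pathLaw_mul_iterate ν P m (j + m * L)
      (A := fun ω => ∏ l ∈ Finset.range L, f (ω (j + m * (l + 1))).1)]
    · calc _ ≤ ∫⁻ ω, (∏ l ∈ Finset.range L, f (ω (j + m * (l + 1))).1) * K ∂pathLaw ν P :=
            lintegral_mono fun ω => mul_le_mul_right (hK _) _
        _ = (∫⁻ ω, (∏ l ∈ Finset.range L, f (ω (j + m * (l + 1))).1) ∂pathLaw ν P) * K :=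
            lintegral_mul_const _ (Finset.measurable_prod _ fun l _ => measurable_state_comp f _)
        _ ≤ _ := by rw [pow_succ]; exact mul_le_mul_left ih _
    · exact Finset.measurable_prod _ fun l _ => measurable_state_comp f _
    · intro ω ω' h
      refine Finset.prod_congr rfl fun l hl => ?_
      have : m * (l + 1) ≤ m * L := Nat.mul_le_mul_left _ (Finset.mem_range.1 hl)
      rw [h _ (by omega)]

/-- If from every state the chain is at `z` after `m` steps with probability at least `1 - K`, with
`K < 1`, then `z` is visited almost surely. -/
lemma ae_exists_visit (m : ℕ) (z : S) {K : ℝ≥0∞} (hK1 : K < 1)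
    (hK : ∀ x, (transOp P)^[m] (({z}ᶜ : Set S).indicator 1) x ≤ K) :
    ∀ᵐ ω ∂pathLaw ν P, ∃ i, (ω i).1 = z := by
  rw [ae_iff]
  refine le_antisymm ?_ zero_le
  have hlim : Tendsto (fun L : ℕ => K ^ L) atTop (𝓝 0) :=
    ENNReal.tendsto_pow_atTop_nhds_zero_of_lt_one hK1
  refine ge_of_tendsto' hlim fun L => ?_
  refine le_trans ?_ (lintegral_prod_le_pow ν P m 0 L hK)
  have hm : MeasurableSet {ω : ℕ → S × ℝ | ¬ ∃ i, (ω i).1 = z} :=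
    measurableSet_setOfPred.2 (Measurable.exists fun i => measurable_state_eq i z).not
  rw [← lintegral_indicator_one hm]
  refine lintegral_mono fun ω => ?_
  by_cases h : ∃ i, (ω i).1 = z
  · simp [h]
  · rw [indicator_of_mem (by exact h)]
    push Not at h
    refine (Finset.prod_eq_one fun l _ => ?_).symm.le
    simp [h]

lemma lintegral_state_prod (n : ℕ) (A : ℕ → Set S) (q : stdSimplex ℝ S) :
    pathLaw q (fun _ => q) {ω | ∀ i < n, (ω i).1 ∈ A i} =
      ∏ i ∈ Finset.range n, ∑ z, ENNReal.ofReal (q.1 z) * (A i).indicator 1 z := by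
  classical
  have hm : ∀ n, MeasurableSet {ω : ℕ → S × ℝ | ∀ i < n, (ω i).1 ∈ A i} := fun n =>
    measurableSet_setOfPred.2 <| Measurable.forall fun i => measurable_const.imp <|
      measurableSet_setOfPred.1 <|
        (measurable_fst.comp (measurable_pi_apply i)) (MeasurableSet.of_discrete (s := A i))
  induction n with
  | zero => simp
  | succ n ih =>
    rw [Finset.prod_range_succ, ← ih, ← lintegral_indicator_one (hm n),
      ← lintegral_indicator_one (hm (n + 1))]
    have h1 : ∀ ω : ℕ → S × ℝ, {ω : ℕ → S × ℝ | ∀ i < n + 1, (ω i).1 ∈ A i}.indicator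
        (1 : (ℕ → S × ℝ) → ℝ≥0∞) ω =
        {ω : ℕ → S × ℝ | ∀ i < n, (ω i).1 ∈ A i}.indicator 1 ω * (A n).indicator 1 (ω n).1 := by
      intro ω
      simp only [indicator_apply, mem_ofPred_eq, Nat.forall_lt_succ_right]
      by_cases h2 : ∀ i < n, (ω i).1 ∈ A i <;> by_cases h3 : (ω n).1 ∈ A n <;> simp [h2, h3]
    rw [lintegral_congr h1]
    have hq : ∀ ω : ℕ → S × ℝ, rate q (fun _ => q) ω n = q := fun ω => by cases n <;> rfl
    rw [lintegral_pathLaw_mul q _ n (measurable_one.indicator (hm n)) (v := (A n).indicator 1)]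
    · simp only [hq]
      exact lintegral_mul_const _ (measurable_one.indicator (hm n))
    · intro ω ω' h
      have : (∀ i < n, (ω i).1 ∈ A i) ↔ ∀ i < n, (ω' i).1 ∈ A i :=
        forall₂_congr fun i hi => by rw [h i hi]
      simp only [indicator_apply, mem_ofPred_eq, this, Pi.one_apply]

lemma isMarkovChain_pathLaw {M : Matrix S S ℝ} (hM : ∀ x y, M x y = (P x).1 y) :
    ChainCoupling.IsMarkovChain M ν.1 (pathLaw ν P)
      (fun i ω => (ω i).1) := by
  classical
  refine ⟨fun i => measurable_fst.comp (measurable_pi_apply i), fun n x => ?_⟩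
  simp only [hM]
  have hm : ∀ n, MeasurableSet {ω : ℕ → S × ℝ | ∀ i < n, (ω i).1 = x i} := fun n =>
    measurableSet_setOfPred.2 <| Measurable.forall fun i => measurable_const.imp <|
      measurable_state_eq i (x i)
  have hstep : ∀ n, pathLaw ν P {ω | ∀ i < n + 1, (ω i).1 = x i} =
      ∫⁻ ω, {ω : ℕ → S × ℝ | ∀ i < n, (ω i).1 = x i}.indicator 1 ω *
        ENNReal.ofReal ((rate ν P ω n).1 (x n)) ∂pathLaw ν P := by
    intro n
    have h1 : ∀ ω : ℕ → S × ℝ, {ω : ℕ → S × ℝ | ∀ i < n + 1, (ω i).1 = x i}.indicator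
        (1 : (ℕ → S × ℝ) → ℝ≥0∞) ω =
        {ω : ℕ → S × ℝ | ∀ i < n, (ω i).1 = x i}.indicator 1 ω *
          (fun z => if z = x n then (1 : ℝ≥0∞) else 0) (ω n).1 := by
      intro ω
      simp only [indicator_apply, mem_ofPred_eq, Nat.forall_lt_succ_right]
      by_cases h2 : ∀ i < n, (ω i).1 = x i <;> by_cases h3 : (ω n).1 = x n <;> simp [h2, h3]
    rw [← lintegral_indicator_one (hm _), lintegral_congr h1]
    rw [lintegral_pathLaw_mul ν P n (measurable_one.indicator (hm n))
      (v := fun z => if z = x n then 1 else 0)]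
    · simp
    · intro ω ω' h
      have : (∀ i < n, (ω i).1 = x i) ↔ ∀ i < n, (ω' i).1 = x i :=
        forall₂_congr fun i hi => by rw [h i hi]
      simp only [indicator_apply, mem_ofPred_eq, this, Pi.one_apply]
  have key : pathLaw ν P {ω | ∀ i < n + 1, (ω i).1 = x i} =
      ENNReal.ofReal (ν.1 (x 0) * ∏ i ∈ Finset.range n, (P (x i)).1 (x (i + 1))) := by
    induction n with
    | zero => rw [hstep 0]; simp [rate]
    | succ n ih =>
      rw [Finset.prod_range_succ, ← mul_assoc, ENNReal.ofReal_mul, ← ih, hstep (n + 1),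
        ← lintegral_indicator_one (hm _), ← lintegral_mul_const _ (measurable_one.indicator (hm _))]
      · refine lintegral_congr fun ω => ?_
        by_cases h : ∀ i < n + 1, (ω i).1 = x i
        · simp only [rate, h n (by omega)]
        · rw [indicator_of_notMem (by exact h), zero_mul, zero_mul]
      · exact mul_nonneg (ν.2.1 _) (Finset.prod_nonneg fun i _ => (P _).2.1 _)
  have hset : {ω : ℕ → S × ℝ | ∀ i ≤ n, (ω i).1 = x i} = {ω | ∀ i < n + 1, (ω i).1 = x i} := by
    simp only [Nat.lt_succ_iff]
  rw [hset, measureReal_def, key, ENNReal.toReal_ofReal]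
  exact mul_nonneg (ν.2.1 _) (Finset.prod_nonneg fun i _ => (P _).2.1 _)

lemma isIID_pathLaw (q : stdSimplex ℝ S) :
    ChainCoupling.IsIID q.1 (pathLaw q (fun _ => q)) (fun i ω => (ω i).1) := by
  classical
  have hone : ∑ z, ENNReal.ofReal (q.1 z) = 1 := by
    rw [← ENNReal.ofReal_sum_of_nonneg fun z _ => q.2.1 z, q.2.2, ENNReal.ofReal_one]
  -- joint probabilities over an arbitrary finite set of times, padding with full sets
  have hprod : ∀ (s : Finset ℕ) (A : ℕ → Set S),
      pathLaw q (fun _ => q) (⋂ i ∈ s, (fun ω => (ω i).1) ⁻¹' A i) =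
        ∏ i ∈ s, ∑ z, ENNReal.ofReal (q.1 z) * (A i).indicator 1 z := by
    intro s A
    obtain ⟨n, hn⟩ : ∃ n, s ⊆ Finset.range n := ⟨s.sup id + 1, fun i hi =>
      Finset.mem_range.2 (Nat.lt_succ_of_le (Finset.le_sup (f := id) hi))⟩
    have h1 := lintegral_state_prod n (fun i => if i ∈ s then A i else univ) q
    have h2 : {ω : ℕ → S × ℝ | ∀ i < n, (ω i).1 ∈ if i ∈ s then A i else univ} =
        ⋂ i ∈ s, (fun ω => (ω i).1) ⁻¹' A i := by
      ext ω
      simp only [mem_ofPred_eq, mem_iInter, mem_preimage]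
      constructor
      · intro h i hi
        have := h i (Finset.mem_range.1 (hn hi))
        rwa [if_pos hi] at this
      · intro h i _
        split_ifs with hi
        · exact h i hi
        · trivial
    rw [← h2, h1, ← Finset.prod_subset hn]
    · exact Finset.prod_congr rfl fun i hi => by simp only [if_pos hi]
    · intro i _ hi
      simp [if_neg hi, hone]
  have hone' : ∀ (i : ℕ) (A : Set S), pathLaw q (fun _ => q) ((fun ω => (ω i).1) ⁻¹' A) =
      ∑ z, ENNReal.ofReal (q.1 z) * A.indicator 1 z := by
    intro i A
    simpa using hprod {i} fun _ => A
  refine ⟨fun i => measurable_fst.comp (measurable_pi_apply i), ?_, fun i x => ?_⟩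
  · rw [iIndepFun_iff_measure_inter_preimage_eq_mul]
    intro s A _
    rw [hprod]
    exact Finset.prod_congr rfl fun i _ => (hone' i _).symm
  · have h := hone' i {x}
    have : (fun ω : ℕ → S × ℝ => (ω i).1) ⁻¹' {x} = {ω | (ω i).1 = x} := rfl
    rw [this] at h
    rw [measureReal_def, h]
    simp [indicator_apply, ENNReal.toReal_ofReal (q.2.1 x)]

end

/-! ### Coupling along an observable, and exponential moments -/

section

/-- Two measures with a common law of an observable can be coupled along it. -/
lemma exists_coupling_of_map_eq {X Y E : Type*} [MeasurableSpace X] [MeasurableSpace Y]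
    [MeasurableSpace E] [MeasurableEq E] [StandardBorelSpace Y] [Nonempty Y]
    (α : Measure X) (β : Measure Y) [IsProbabilityMeasure α] [IsProbabilityMeasure β]
    {f : X → E} {g : Y → E} (hf : Measurable f) (hg : Measurable g)
    (h : α.map f = β.map g) :
    ∃ Q : Measure (X × Y), IsProbabilityMeasure Q ∧ Q.map Prod.fst = α ∧ Q.map Prod.snd = β ∧
      ∀ᵐ p ∂Q, f p.1 = g p.2 := by
  set κ : Kernel E Y := condDistrib id g β with hκ
  set Q : Measure (X × Y) := α ⊗ₘ κ.comap f hf with hQ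
  have h1 : Q.map (Prod.map f id) = β.map (fun y => (g y, y)) := by
    have h2 := compProd_map_condDistrib (mβ := ‹MeasurableSpace E›) (X := g) (Y := id) (μ := β)
      aemeasurable_id
    rw [← hκ, ← h] at h2
    rw [show (fun y => (g y, y)) = fun a => (g a, id a) from rfl, ← h2]
    ext s hs
    rw [Measure.map_apply (by fun_prop) hs,
      Measure.compProd_apply ((hf.prodMap measurable_id) hs), Measure.compProd_apply hs,
      lintegral_map (Kernel.measurable_kernel_prodMk_left hs) hf]
    rfl
  refine ⟨Q, inferInstance, ?_, ?_, ?_⟩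
  · exact Measure.fst_compProd α _
  · have h2 := congrArg (Measure.map Prod.snd) h1
    rw [Measure.map_map measurable_snd (by fun_prop),
      Measure.map_map measurable_snd (by fun_prop)] at h2
    exact h2.trans Measure.map_id
  · have hm : MeasurableSet {p : E × Y | p.1 = g p.2} :=
      measurableSet_eq_fun measurable_fst (hg.comp measurable_snd)
    have h2 : ∀ᵐ p ∂Q.map (Prod.map f id), p.1 = g p.2 := by
      rw [h1, ae_map_iff (by fun_prop) hm]
      exact Eventually.of_forall fun y => rfl
    exact ae_of_ae_map (by fun_prop) h2

variable {S : Type*} [Fintype S] [MeasurableSpace S] [DiscreteMeasurableSpace S]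
variable (ν : stdSimplex ℝ S) (P : S → stdSimplex ℝ S)

lemma measure_hold_zero_ge {b : ℝ} (hb : 0 ≤ b) :
    pathLaw ν P {ω | b ≤ (ω 0).2} = ENNReal.ofReal (Real.exp (-b)) := by
  have h := expMeasure_one_Ici b
  rw [max_eq_left hb] at h
  rw [← h]
  have hm : MeasurableSet {w : S × ℝ | b ≤ w.2} := measurableSet_Ici.preimage measurable_snd
  have h1 : pathLaw ν P {ω | b ≤ (ω 0).2} =
      ((pathLaw ν P).map fun ω => ω 0) {w | b ≤ w.2} :=
    (Measure.map_apply (by fun_prop) hm).symm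
  rw [h1, pathLaw_map_zero, ← lintegral_indicator_one hm,
    lintegral_markLaw _ (measurable_one.indicator hm)]
  have h2 : ∀ z : S, ∫⁻ s, {w : S × ℝ | b ≤ w.2}.indicator 1 (z, s) ∂expMeasure 1 =
      expMeasure 1 (Ici b) := by
    intro z
    rw [← lintegral_indicator_one measurableSet_Ici]
    rfl
  simp_rw [h2]
  rw [← Finset.sum_mul, ← ENNReal.ofReal_sum_of_nonneg fun z _ => ν.2.1 z, ν.2.2,
    ENNReal.ofReal_one, one_mul]

/-- Iterating `v ↦ e^c · P v`, started from the constant `1`. -/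
def feynmanKac (P : S → stdSimplex ℝ S) (c : S → ℝ) : ℕ → S → ℝ≥0∞
  | 0 => 1
  | n + 1 => fun x => ENNReal.ofReal (Real.exp (c x)) * transOp P (feynmanKac P c n) x

lemma lintegral_exp_sum_state (c : S → ℝ) (k L : ℕ) :
    ∫⁻ ω, ENNReal.ofReal (Real.exp (∑ i ∈ Finset.range k, c (ω i).1)) *
        feynmanKac P c L (ω k).1 ∂pathLaw ν P =
      ∫⁻ ω, feynmanKac P c (L + k) (ω 0).1 ∂pathLaw ν P := by
  induction k generalizing L with
  | zero => simp
  | succ k ih =>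
    rw [add_comm k 1, ← add_assoc, ← ih, add_comm 1 k, lintegral_pathLaw_mul ν P (k + 1)]
    · refine lintegral_congr fun ω => ?_
      rw [Finset.sum_range_succ, Real.exp_add, ENNReal.ofReal_mul (Real.exp_pos _).le, mul_assoc]
      rfl
    · refine (Measurable.exp (Finset.measurable_sum _ fun i _ => ?_)).ennreal_ofReal
      exact (Measurable.of_discrete (f := c)).comp (measurable_fst.comp (measurable_pi_apply i))
    · intro ω ω' h
      rw [Finset.sum_congr rfl fun i hi => by rw [h i (Finset.mem_range.1 hi)]]

lemma lintegral_exp_sum_hold_le {a : S → ℝ} (ha : ∀ x, |a x| ≤ 1 / 4) (k L : ℕ) :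
    ∫⁻ ω, ENNReal.ofReal (Real.exp (∑ i ∈ Finset.range k, a (ω i).1 * (ω (i + 1)).2)) *
        feynmanKac P (fun x => a x + a x ^ 2) L (ω k).1 ∂pathLaw ν P ≤
      ∫⁻ ω, feynmanKac P (fun x => a x + a x ^ 2) (L + k) (ω 0).1 ∂pathLaw ν P := by
  induction k generalizing L with
  | zero => simp
  | succ k ih =>
    rw [add_comm k 1, ← add_assoc]
    refine le_trans ?_ (ih (L + 1))
    rw [add_comm 1 k]
    set A : (ℕ → S × ℝ) → ℝ≥0∞ := fun ω =>
      ENNReal.ofReal (Real.exp (∑ i ∈ Finset.range k, a (ω i).1 * (ω (i + 1)).2)) with hA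
    have ham : Measurable a := Measurable.of_discrete
    have hAm : Measurable A := by
      refine (Measurable.exp (Finset.measurable_sum _ fun i _ => ?_)).ennreal_ofReal
      exact (ham.comp (measurable_fst.comp (measurable_pi_apply i))).mul
        (measurable_snd.comp (measurable_pi_apply (i + 1)))
    set v := feynmanKac P (fun x => a x + a x ^ 2) L with hv
    have hvm : Measurable v := Measurable.of_discrete
    set F : (ℕ → S × ℝ) → S × ℝ → ℝ≥0∞ := fun ω w =>
      A ω * (ENNReal.ofReal (Real.exp (a (ω k).1 * w.2)) * v w.1) with hF
    have hFm : Measurable (Function.uncurry F) := by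
      refine (hAm.comp measurable_fst).mul (Measurable.mul ?_ ?_)
      · refine (Measurable.exp (Measurable.mul ?_ ?_)).ennreal_ofReal
        · exact ham.comp (measurable_fst.comp ((measurable_pi_apply k).comp measurable_fst))
        · exact measurable_snd.comp measurable_snd
      · exact hvm.comp (measurable_fst.comp measurable_snd)
    have h1 : ∀ ω, ENNReal.ofReal (Real.exp (∑ i ∈ Finset.range (k + 1),
        a (ω i).1 * (ω (i + 1)).2)) * v (ω (k + 1)).1 = F ω (ω (k + 1)) := by
      intro ω
      rw [Finset.sum_range_succ, Real.exp_add, ENNReal.ofReal_mul (Real.exp_pos _).le, mul_assoc]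
    rw [lintegral_congr h1, lintegral_pathLaw_succ ν P k hFm]
    · refine lintegral_mono fun ω => ?_
      have hm1 : Measurable fun w : S × ℝ =>
          ENNReal.ofReal (Real.exp (a (ω k).1 * w.2)) * v w.1 := by fun_prop
      simp only [hF]
      rw [lintegral_const_mul _ hm1, lintegral_markLaw _ hm1]
      refine mul_le_mul_right ?_ _
      change _ ≤ ENNReal.ofReal (Real.exp (a (ω k).1 + a (ω k).1 ^ 2)) *
        ∑ z, ENNReal.ofReal ((P (ω k).1).1 z) * v z
      rw [Finset.mul_sum]
      refine Finset.sum_le_sum fun z _ => ?_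
      dsimp only
      rw [lintegral_mul_const _ (by fun_prop), mul_left_comm]
      refine mul_le_mul_left ?_ _
      exact lintegral_exp_mul_expMeasure_le (ha _)
    · intro ω ω' h
      have h2 : A ω = A ω' := by
        simp only [hA]
        rw [Finset.sum_congr rfl fun i hi => by
          have := Finset.mem_range.1 hi
          rw [h i (by omega), h (i + 1) (by omega)]]
      simp only [hF, h2, h k le_rfl]

/-- Integrating out the holding times in an exponential moment of the soft local time. -/
lemma lintegral_exp_hold_le_state {a : S → ℝ} (ha : ∀ x, |a x| ≤ 1 / 4) (n : ℕ) :
    ∫⁻ ω, ENNReal.ofReal (Real.exp (∑ i ∈ Finset.range n, a (ω i).1 * (ω (i + 1)).2)) ∂pathLaw ν P ≤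
      ∫⁻ ω, ENNReal.ofReal (Real.exp (∑ i ∈ Finset.range n, (a (ω i).1 + a (ω i).1 ^ 2)))
        ∂pathLaw ν P := by
  have h1 := lintegral_exp_sum_hold_le ν P ha n 0
  have h2 := lintegral_exp_sum_state ν P (fun x => a x + a x ^ 2) n 0
  rw [← h2] at h1
  simpa only [feynmanKac, Pi.one_apply, mul_one] using h1

lemma exp_average_le {m : ℕ} (hm : 0 < m) (y : ℕ → ℝ) :
    Real.exp ((1 / m) * ∑ j ∈ Finset.range m, y j) ≤
      (1 / m) * ∑ j ∈ Finset.range m, Real.exp (y j) := by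
  have hm' : (0 : ℝ) < m := by exact_mod_cast hm
  have := convexOn_exp.map_sum_le (t := Finset.range m) (w := fun _ => (1 / m : ℝ)) (p := y)
    (fun _ _ => by positivity) (by simp [hm'.ne']) (fun _ _ => mem_univ _)
  simpa [Finset.mul_sum] using this

lemma sum_range_mul_eq (f : ℕ → ℝ) (m q : ℕ) :
    ∑ i ∈ Finset.range (m * q), f i =
      ∑ j ∈ Finset.range m, ∑ l ∈ Finset.range q, f (j + m * l) := by
  induction q with
  | zero => simp
  | succ q ih =>
    rw [mul_add_one, Finset.sum_range_add, ih, ← Finset.sum_add_distrib]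
    refine Finset.sum_congr rfl fun j _ => ?_
    rw [Finset.sum_range_succ, add_comm (m * q)]

/-- Exponential moments of ergodic averages, by convexity over the residue classes of times
modulo `m`: within a class, consecutive times are `m` steps apart. -/
lemma lintegral_exp_average_le {m : ℕ} (hm : 0 < m) {h : S → ℝ} (hh : ∀ x, |h x| ≤ 1) {η : ℝ}
    (hη : 0 ≤ η)
    (hK : ∀ x, (transOp P)^[m] (fun y => ENNReal.ofReal (Real.exp (h y))) x ≤
      ENNReal.ofReal (Real.exp η)) (n : ℕ) :
    ∫⁻ ω, ENNReal.ofReal (Real.exp ((1 / m) * ∑ i ∈ Finset.range n, h (ω i).1)) ∂pathLaw ν P ≤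
      ENNReal.ofReal (Real.exp (2 + n / m * η)) := by
  have hm' : (0 : ℝ) < m := by exact_mod_cast hm
  have hhm : Measurable h := Measurable.of_discrete
  set q := n / m with hq
  have hn : n = m * q + n % m := (Nat.div_add_mod n m).symm
  -- the incomplete last block contributes at most `1` to the exponent
  have hrem : ∀ ω : ℕ → S × ℝ, (1 / m : ℝ) * ∑ i ∈ Finset.range n, h (ω i).1 ≤
      1 + (1 / m) * ∑ j ∈ Finset.range m, ∑ l ∈ Finset.range q, h (ω (j + m * l)).1 := by
    intro ω
    rw [hn, Finset.sum_range_add, sum_range_mul_eq (fun i => h (ω i).1), mul_add, add_comm]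
    gcongr
    have h1 : ∑ i ∈ Finset.range (n % m), h (ω (m * q + i)).1 ≤ ∑ i ∈ Finset.range (n % m), 1 :=
      Finset.sum_le_sum fun i _ => (abs_le.1 (hh _)).2
    have h2 : ((n % m : ℕ) : ℝ) ≤ m := by exact_mod_cast (Nat.mod_lt n hm).le
    rw [Finset.sum_const, Finset.card_range, nsmul_eq_mul, mul_one] at h1
    rw [one_div, inv_mul_le_iff₀ hm']
    linarith
  have hclass : ∀ j, ∫⁻ ω, ENNReal.ofReal
      (Real.exp (∑ l ∈ Finset.range q, h (ω (j + m * l)).1)) ∂pathLaw ν P ≤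
      ENNReal.ofReal (Real.exp (1 + n / m * η)) := by
    intro j
    rcases Nat.eq_zero_or_pos q with h0 | h0
    · rw [h0]
      simp only [Finset.range_zero, Finset.sum_empty, lintegral_const, measure_univ, mul_one]
      exact ENNReal.ofReal_le_ofReal (Real.exp_le_exp.2 (by positivity))
    obtain ⟨L, hL⟩ : ∃ L, q = L + 1 := ⟨q - 1, by omega⟩
    have hLn : (L : ℝ) ≤ n / m := by
      have h1 : (q : ℝ) ≤ n / m := Nat.cast_div_le
      have h2 : (q : ℝ) = L + 1 := by rw [hL]; push_cast; ring
      linarith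
    have hpt : ∀ ω : ℕ → S × ℝ,
        ENNReal.ofReal (Real.exp (∑ l ∈ Finset.range q, h (ω (j + m * l)).1)) ≤
        ENNReal.ofReal (Real.exp 1) * ∏ l ∈ Finset.range L,
          (fun y => ENNReal.ofReal (Real.exp (h y))) (ω (j + m * (l + 1))).1 := by
      intro ω
      rw [hL, Finset.sum_range_succ', Real.exp_add, Real.exp_sum, mul_comm,
        ENNReal.ofReal_mul (Real.exp_pos _).le,
        ENNReal.ofReal_prod_of_nonneg fun _ _ => (Real.exp_pos _).le]
      gcongr
      exact (abs_le.1 (hh _)).2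
    calc _ ≤ _ := lintegral_mono hpt
      _ = ENNReal.ofReal (Real.exp 1) * _ := lintegral_const_mul _
          (Finset.measurable_prod _ fun l _ => measurable_state_comp
            (fun y => ENNReal.ofReal (Real.exp (h y))) _)
      _ ≤ ENNReal.ofReal (Real.exp 1) * ENNReal.ofReal (Real.exp η) ^ L :=
          mul_le_mul_right (lintegral_prod_le_pow ν P m j L hK) _
      _ = ENNReal.ofReal (Real.exp (1 + L * η)) := by
          rw [← ENNReal.ofReal_pow (Real.exp_pos _).le, ← ENNReal.ofReal_mul (Real.exp_pos _).le,
            ← Real.exp_nat_mul, ← Real.exp_add]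
      _ ≤ _ := by gcongr
  have hpt : ∀ ω : ℕ → S × ℝ,
      ENNReal.ofReal (Real.exp ((1 / m) * ∑ i ∈ Finset.range n, h (ω i).1)) ≤
      ENNReal.ofReal (Real.exp 1) * (ENNReal.ofReal (1 / m) * ∑ j ∈ Finset.range m,
        ENNReal.ofReal (Real.exp (∑ l ∈ Finset.range q, h (ω (j + m * l)).1))) := by
    intro ω
    rw [← ENNReal.ofReal_sum_of_nonneg fun _ _ => (Real.exp_pos _).le,
      ← ENNReal.ofReal_mul (by positivity), ← ENNReal.ofReal_mul (Real.exp_pos _).le]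
    refine ENNReal.ofReal_le_ofReal ((Real.exp_le_exp.2 (hrem ω)).trans ?_)
    rw [Real.exp_add]
    exact mul_le_mul_of_nonneg_left (exp_average_le hm _) (Real.exp_pos _).le
  have hmeas : ∀ j, Measurable fun ω : ℕ → S × ℝ =>
      ENNReal.ofReal (Real.exp (∑ l ∈ Finset.range q, h (ω (j + m * l)).1)) := fun j =>
    (Measurable.exp (Finset.measurable_sum _ fun l _ =>
      hhm.comp (measurable_fst.comp (measurable_pi_apply _)))).ennreal_ofReal
  refine (lintegral_mono hpt).trans ?_
  rw [lintegral_const_mul _ ((Finset.measurable_sum _ fun j _ => hmeas j).const_mul _),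
    lintegral_const_mul _ (Finset.measurable_sum _ fun j _ => hmeas j),
    lintegral_finsetSum _ fun j _ => hmeas j]
  calc _ ≤ ENNReal.ofReal (Real.exp 1) * (ENNReal.ofReal (1 / m) * ∑ j ∈ Finset.range m,
        ENNReal.ofReal (Real.exp (1 + n / m * η))) := by
        gcongr with j _
        exact hclass j
    _ = ENNReal.ofReal (Real.exp 1) * ENNReal.ofReal (Real.exp (1 + n / m * η)) := by
        rw [Finset.sum_const, Finset.card_range, nsmul_eq_mul, ← mul_assoc (ENNReal.ofReal (1 / m)),
          ← ENNReal.ofReal_natCast m, ← ENNReal.ofReal_mul (by positivity),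
          one_div_mul_cancel hm'.ne', ENNReal.ofReal_one, one_mul]
    _ = _ := by
        rw [← ENNReal.ofReal_mul (Real.exp_pos _).le, ← Real.exp_add]
        ring_nf

end

/-! ### Concentration of soft local times -/

section

/-- Exponential Markov inequality in the form used below. -/
lemma measure_le_of_lintegral_exp_le {Ω : Type*} [MeasurableSpace Ω] {Q : Measure Ω}
    {X : Ω → ℝ} (hX : Measurable X) {c B : ℝ}
    (h : ∫⁻ ω, ENNReal.ofReal (Real.exp (X ω)) ∂Q ≤ ENNReal.ofReal B) :
    Q {ω | c ≤ X ω} ≤ ENNReal.ofReal (Real.exp (-c) * B) := by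
  have h1 := mul_meas_ge_le_lintegral₀ (μ := Q) (f := fun ω => ENNReal.ofReal (Real.exp (X ω)))
    hX.exp.ennreal_ofReal.aemeasurable (ENNReal.ofReal (Real.exp c))
  have h2 : {ω | ENNReal.ofReal (Real.exp c) ≤ ENNReal.ofReal (Real.exp (X ω))} =
      {ω | c ≤ X ω} := by
    ext ω
    simp [ENNReal.ofReal_le_ofReal_iff (Real.exp_pos _).le]
  rw [h2] at h1
  have h3 := h1.trans h
  calc Q {ω | c ≤ X ω} = ENNReal.ofReal (Real.exp (-c)) *
        (ENNReal.ofReal (Real.exp c) * Q {ω | c ≤ X ω}) := by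
        rw [← mul_assoc, ← ENNReal.ofReal_mul (Real.exp_pos _).le, ← Real.exp_add]
        simp
    _ ≤ ENNReal.ofReal (Real.exp (-c)) * ENNReal.ofReal B := mul_le_mul_right h3 _
    _ = _ := (ENNReal.ofReal_mul (Real.exp_pos _).le).symm

/-- Near stationarity, the exponential moment of a small perturbation of a centred function
`lam * s * q` is governed by the variance `V` of `q`. -/
lemma transOp_exp_le {S : Type*} [Fintype S] [DecidableEq S] (P : S → stdSimplex ℝ S)
    {M : Matrix S S ℝ} (hM : ∀ x y, M x y = (P x).1 y)
    {π : stdSimplex ℝ S} {m : ℕ} {δ : ℝ} (hδ : 0 ≤ δ)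
    (hmix : ∀ x y, (M ^ m) x y ≤ (1 + δ) * π.1 y) {q : S → ℝ} {V lam s : ℝ}
    (hlam : 0 ≤ lam) (hs : s = 1 ∨ s = -1) (hmean : ∑ y, π.1 y * q y = 0)
    (hvar : ∑ y, π.1 y * q y ^ 2 = V) (hq : ∀ y, lam * |q y| ≤ 1 / 128) (x : S) :
    (transOp P)^[m] (fun y => ENNReal.ofReal (Real.exp (lam * (s * q y + 2 * lam * q y ^ 2)))) x ≤
      ENNReal.ofReal (Real.exp (δ + 4 * lam ^ 2 * V)) := by
  rw [iterate_transOp P hM]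
  have hpt : ∀ y, Real.exp (lam * (s * q y + 2 * lam * q y ^ 2)) ≤
      1 + lam * s * q y + 4 * lam ^ 2 * q y ^ 2 := by
    intro y
    have h1 := hq y
    set r := lam * q y with hr
    have hra : |r| ≤ 1 / 128 := by rwa [hr, abs_mul, abs_of_nonneg hlam]
    have hra' := abs_le.1 hra
    have hh : lam * (s * q y + 2 * lam * q y ^ 2) = s * r + 2 * r ^ 2 := by rw [hr]; ring
    have hgoal : 1 + lam * s * q y + 4 * lam ^ 2 * q y ^ 2 = 1 + s * r + 4 * r ^ 2 := by
      rw [hr]; ring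
    rw [hh, hgoal]
    have hr2 : r ^ 2 ≤ 1 / 16384 := by nlinarith
    have habs : |s * r + 2 * r ^ 2| ≤ 1 := by
      rcases hs with rfl | rfl <;> rw [abs_le] <;> constructor <;> nlinarith
    have h2 := (abs_le.1 (Real.abs_exp_sub_one_sub_id_le habs)).2
    have h3 : (s * r + 2 * r ^ 2) ^ 2 ≤ 2 * r ^ 2 := by
      have : (s * r + 2 * r ^ 2) ^ 2 = r ^ 2 * (s + 2 * r) ^ 2 := by ring
      rw [this, mul_comm 2 (r ^ 2)]
      refine mul_le_mul_of_nonneg_left ?_ (sq_nonneg r)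
      rcases hs with rfl | rfl <;> nlinarith
    linarith
  have h1 : ∀ y, ENNReal.ofReal ((M ^ m) x y) *
      ENNReal.ofReal (Real.exp (lam * (s * q y + 2 * lam * q y ^ 2))) ≤
      ENNReal.ofReal ((1 + δ) * (π.1 y * Real.exp (lam * (s * q y + 2 * lam * q y ^ 2)))) := by
    intro y
    rw [← mul_assoc, ENNReal.ofReal_mul (mul_nonneg (by linarith) (π.2.1 y))]
    exact mul_le_mul_left (ENNReal.ofReal_le_ofReal (hmix x y)) _
  refine (Finset.sum_le_sum fun y _ => h1 y).trans ?_
  rw [← ENNReal.ofReal_sum_of_nonneg fun y _ =>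
    mul_nonneg (by linarith) (mul_nonneg (π.2.1 y) (Real.exp_pos _).le), ← Finset.mul_sum]
  refine ENNReal.ofReal_le_ofReal ?_
  have h2 : ∑ y, π.1 y * Real.exp (lam * (s * q y + 2 * lam * q y ^ 2)) ≤ 1 + 4 * lam ^ 2 * V := by
    calc _ ≤ ∑ y, π.1 y * (1 + lam * s * q y + 4 * lam ^ 2 * q y ^ 2) :=
          Finset.sum_le_sum fun y _ => mul_le_mul_of_nonneg_left (hpt y) (π.2.1 y)
      _ = ∑ y, π.1 y + lam * s * ∑ y, π.1 y * q y + 4 * lam ^ 2 * ∑ y, π.1 y * q y ^ 2 := by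
          rw [Finset.mul_sum, Finset.mul_sum, ← Finset.sum_add_distrib, ← Finset.sum_add_distrib]
          exact Finset.sum_congr rfl fun y _ => by ring
      _ = _ := by rw [π.2.2, hmean, hvar]; ring
  have hV : 0 ≤ V := hvar ▸ Finset.sum_nonneg fun y _ => mul_nonneg (π.2.1 y) (sq_nonneg _)
  calc (1 + δ) * _ ≤ (1 + δ) * (1 + 4 * lam ^ 2 * V) := mul_le_mul_of_nonneg_left h2 (by linarith)
    _ ≤ Real.exp δ * Real.exp (4 * lam ^ 2 * V) := by
        have := Real.add_one_le_exp δ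
        have := Real.add_one_le_exp (4 * lam ^ 2 * V)
        gcongr <;> linarith
    _ = _ := (Real.exp_add _ _).symm

lemma measurable_sum_hold {S : Type*} [MeasurableSpace S] (b : ℝ) (N : ℕ) :
    Measurable fun ω : ℕ → S × ℝ => b * ∑ i ∈ Finset.range N, (ω i).2 :=
  (Finset.measurable_sum _ fun i _ => measurable_snd.comp (measurable_pi_apply i)).const_mul b

variable {S : Type*} [Fintype S] [MeasurableSpace S] [DiscreteMeasurableSpace S]
variable (ν : stdSimplex ℝ S) (P : S → stdSimplex ℝ S)

lemma lintegral_exp_sum_hold_le_exp {b : ℝ} (hb : |b| ≤ 1 / 4) (N : ℕ) :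
    ∫⁻ ω, ENNReal.ofReal (Real.exp (b * ∑ i ∈ Finset.range N, (ω i).2)) ∂pathLaw ν P ≤
      ENNReal.ofReal (Real.exp (N * (b + b ^ 2))) := by
  induction N with
  | zero => simp
  | succ N ih =>
    set F : (ℕ → S × ℝ) → S × ℝ → ℝ≥0∞ := fun ω w =>
      ENNReal.ofReal (Real.exp (b * ∑ i ∈ Finset.range N, (ω i).2)) *
        ENNReal.ofReal (Real.exp (b * w.2)) with hF
    have hFm : Measurable (Function.uncurry F) :=
      (((measurable_sum_hold b N).comp measurable_fst).exp.ennreal_ofReal).mul (by fun_prop)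
    have h1 : ∀ ω : ℕ → S × ℝ, ENNReal.ofReal (Real.exp (b * ∑ i ∈ Finset.range (N + 1), (ω i).2)) =
        F ω (ω N) := by
      intro ω
      rw [Finset.sum_range_succ, mul_add, Real.exp_add, ENNReal.ofReal_mul (Real.exp_pos _).le]
    have hd : ∀ ω ω' : ℕ → S × ℝ, (∀ i < N, ω i = ω' i) → F ω = F ω' := by
      intro ω ω' h
      have : ∑ i ∈ Finset.range N, (ω i).2 = ∑ i ∈ Finset.range N, (ω' i).2 :=
        Finset.sum_congr rfl fun i hi => by rw [h i (Finset.mem_range.1 hi)]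
      simp only [hF, this]
    rw [lintegral_congr h1, lintegral_pathLaw_step ν P N hFm hd]
    have h2 : ∀ ω, ∫⁻ w, F ω w ∂markLaw (rate ν P ω N) ≤
        ENNReal.ofReal (Real.exp (b * ∑ i ∈ Finset.range N, (ω i).2)) *
          ENNReal.ofReal (Real.exp (b + b ^ 2)) := by
      intro ω
      have hm1 : Measurable fun w : S × ℝ => ENNReal.ofReal (Real.exp (b * w.2)) := by fun_prop
      simp only [hF]
      rw [lintegral_const_mul _ hm1, lintegral_markLaw _ hm1]
      dsimp only
      rw [← Finset.sum_mul,
        ← ENNReal.ofReal_sum_of_nonneg fun z _ => (rate ν P ω N).2.1 z, (rate ν P ω N).2.2,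
        ENNReal.ofReal_one, one_mul]
      exact mul_le_mul_right (lintegral_exp_mul_expMeasure_le hb) _
    refine (lintegral_mono h2).trans ?_
    rw [lintegral_mul_const _ (measurable_sum_hold b N).exp.ennreal_ofReal]
    refine (mul_le_mul_left ih _).trans (le_of_eq ?_)
    rw [← ENNReal.ofReal_mul (Real.exp_pos _).le, ← Real.exp_add]
    push_cast
    ring_nf

/-- A sum of at most `n (1 - ε) + 1` standard exponential times is unlikely to exceed
`n (1 - 3 ε / 4)`. -/
lemma measure_sum_hold_ge_le {ε : ℝ} (hε : 0 < ε) (hε2 : ε ≤ 1 / 2) (n N : ℕ)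
    (hN : (N : ℝ) ≤ n * (1 - ε) + 1) :
    pathLaw ν P {ω | n * (1 - 3 * ε / 4) ≤ ∑ i ∈ Finset.range N, (ω i).2} ≤
      ENNReal.ofReal (Real.exp 1 * Real.exp (-(n * ε ^ 2 / 256))) := by
  have hb : |ε / 16| ≤ 1 / 4 := by rw [abs_of_pos (by positivity)]; linarith
  have h := measure_le_of_lintegral_exp_le (measurable_sum_hold (ε / 16) N)
    (c := ε / 16 * (n * (1 - 3 * ε / 4))) (lintegral_exp_sum_hold_le_exp ν P hb N)
  have hset : {ω : ℕ → S × ℝ | ε / 16 * (n * (1 - 3 * ε / 4)) ≤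
      ε / 16 * ∑ i ∈ Finset.range N, (ω i).2} =
      {ω | n * (1 - 3 * ε / 4) ≤ ∑ i ∈ Finset.range N, (ω i).2} := by
    ext ω
    exact mul_le_mul_iff_right₀ (show (0 : ℝ) < ε / 16 by positivity)
  rw [hset] at h
  refine h.trans (ENNReal.ofReal_le_ofReal ?_)
  rw [← Real.exp_add, ← Real.exp_add, Real.exp_le_exp]
  have hn : (0 : ℝ) ≤ n := Nat.cast_nonneg n
  have h1 : (N : ℝ) * (ε / 16 + (ε / 16) ^ 2) ≤ (n * (1 - ε) + 1) * (ε / 16 + (ε / 16) ^ 2) :=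
    mul_le_mul_of_nonneg_right hN (by positivity)
  nlinarith [mul_nonneg hn (sq_nonneg ε), mul_nonneg hn (pow_pos hε 3).le]

/-- A sum of at least `n (1 + ε)` standard exponential times is unlikely to stay below
`n (1 + 3 ε / 4)`. -/
lemma measure_sum_hold_le_le {ε : ℝ} (hε : 0 < ε) (hε2 : ε ≤ 1 / 2) (n N : ℕ)
    (hN : n * (1 + ε) ≤ (N : ℝ)) :
    pathLaw ν P {ω | ∑ i ∈ Finset.range N, (ω i).2 ≤ n * (1 + 3 * ε / 4)} ≤
      ENNReal.ofReal (Real.exp 1 * Real.exp (-(n * ε ^ 2 / 256))) := by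
  have hb : |-(ε / 16)| ≤ 1 / 4 := by rw [abs_neg, abs_of_pos (by positivity)]; linarith
  have h := measure_le_of_lintegral_exp_le (measurable_sum_hold (-(ε / 16)) N)
    (c := -(ε / 16) * (n * (1 + 3 * ε / 4))) (lintegral_exp_sum_hold_le_exp ν P hb N)
  have hset : {ω : ℕ → S × ℝ | -(ε / 16) * (n * (1 + 3 * ε / 4)) ≤
      -(ε / 16) * ∑ i ∈ Finset.range N, (ω i).2} =
      {ω | ∑ i ∈ Finset.range N, (ω i).2 ≤ n * (1 + 3 * ε / 4)} := by
    ext ω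
    simp only [mem_ofPred_eq, neg_mul, neg_le_neg_iff]
    exact mul_le_mul_iff_right₀ (show (0 : ℝ) < ε / 16 by positivity)
  rw [hset] at h
  refine h.trans (ENNReal.ofReal_le_ofReal ?_)
  rw [← Real.exp_add, ← Real.exp_add, Real.exp_le_exp]
  have hn : (0 : ℝ) ≤ n := Nat.cast_nonneg n
  have h1 : (N : ℝ) * (ε / 16 - (ε / 16) ^ 2) ≥ (n * (1 + ε)) * (ε / 16 - (ε / 16) ^ 2) :=
    mul_le_mul_of_nonneg_right hN (by nlinarith)
  nlinarith [mul_nonneg hn (sq_nonneg ε), mul_nonneg (mul_nonneg hn (sq_nonneg ε))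
    (sub_nonneg.2 hε2)]

/-- Laplace transform of the soft local time at `z` with small parameter `ell`, for both signs `s`,
from the exponential moment `η` of the associated function of the state at the larger scale
`lam ≥ m * ell`. -/
lemma lintegral_exp_softTime_le {m : ℕ} (hm : 0 < m) {g B s lam ell η : ℝ} (z : S)
    (hs : s = 1 ∨ s = -1) (hg : 0 < g) (hgB : g ≤ B) (hB : ∀ x, (P x).1 z ≤ B) (hlam0 : 0 < lam)
    (hlamB : lam * B ≤ 1 / 128) (hell0 : 0 < ell) (hell1 : ell ≤ lam / m) (hη0 : 0 ≤ η)
    (hKq : ∀ x, (transOp P)^[m] (fun y => ENNReal.ofReal (Real.exp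
      (lam * (s * ((P y).1 z - g) + 2 * lam * ((P y).1 z - g) ^ 2)))) x ≤
      ENNReal.ofReal (Real.exp η)) (n : ℕ) :
    ∫⁻ ω, ENNReal.ofReal (Real.exp (∑ i ∈ Finset.range n,
        s * ell * (P (ω i).1).1 z * (ω (i + 1)).2)) ∂pathLaw ν P ≤
      ENNReal.ofReal (Real.exp (n * (s * ell * g + 2 * ell ^ 2 * g ^ 2) +
        (2 + n * ell * η / lam)) * 2) := by
  have hm' : (0 : ℝ) < m := by exact_mod_cast hm
  have hm1 : (1 : ℝ) ≤ m := by exact_mod_cast hm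
  have hn : (0 : ℝ) ≤ n := Nat.cast_nonneg n
  have hp0 : ∀ x, 0 ≤ (P x).1 z := fun x => (P x).2.1 z
  have hs2 : s ^ 2 = 1 := by rcases hs with rfl | rfl <;> norm_num
  have hsabs : |s| = 1 := by rcases hs with rfl | rfl <;> norm_num
  have hell1' : ell ≤ lam := hell1.trans (div_le_self hlam0.le hm1)
  set a : S → ℝ := fun x => s * ell * (P x).1 z with ha
  have haB : ∀ x, |a x| ≤ 1 / 4 := by
    intro x
    rw [ha, abs_mul, abs_mul, hsabs, one_mul, abs_of_pos hell0, abs_of_nonneg (hp0 x)]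
    have := mul_le_mul hell1' (hB x) (hp0 x) hlam0.le
    linarith
  set h : S → ℝ := fun x => lam * (s * ((P x).1 z - g) + 2 * lam * ((P x).1 z - g) ^ 2) with hh
  have hh1 : ∀ x, |h x| ≤ 1 := by
    intro x
    have h1 : |lam * ((P x).1 z - g)| ≤ 1 / 128 := by
      rw [abs_mul, abs_of_pos hlam0]
      refine (mul_le_mul_of_nonneg_left ?_ hlam0.le).trans hlamB
      exact abs_le.2 ⟨by linarith [hp0 x], by linarith [hB x]⟩
    have h2 := abs_le.1 h1
    have h3 : h x = s * (lam * ((P x).1 z - g)) + 2 * (lam * ((P x).1 z - g)) ^ 2 := by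
      simp only [hh]; ring
    rw [h3]
    generalize lam * ((P x).1 z - g) = r at h2
    rw [abs_le]
    rcases hs with rfl | rfl <;> constructor <;> nlinarith
  have havg := lintegral_exp_average_le ν P hm hh1 hη0 hKq n
  set Bd : ℝ := 2 + n / m * η with hBd
  set θ : ℝ := ell * m / lam with hθ
  have hθ0 : 0 ≤ θ := by positivity
  have hθ1 : θ ≤ 1 := by
    rw [hθ, div_le_one hlam0]
    exact (le_div_iff₀ hm').1 hell1
  have hθB : θ * Bd ≤ 2 + n * ell * η / lam := by
    have : θ * (n / m * η) = n * ell * η / lam := by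
      rw [hθ]; field_simp
    rw [hBd, mul_add, this]
    linarith
  -- pointwise comparison of the exponents, using `ell ≤ lam / m ≤ lam`
  have hpt : ∀ ω : ℕ → S × ℝ, ∑ i ∈ Finset.range n, (a (ω i).1 + a (ω i).1 ^ 2) ≤
      n * (s * ell * g + 2 * ell ^ 2 * g ^ 2) + θ * Bd +
        θ * ((1 / m) * ∑ i ∈ Finset.range n, h (ω i).1 - Bd) := by
    intro ω
    have h1 : ∀ x, a x + a x ^ 2 ≤ (s * ell * g + 2 * ell ^ 2 * g ^ 2) + ell / lam * h x := by
      intro x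
      have h3 : ell / lam * h x =
          ell * (s * ((P x).1 z - g) + 2 * lam * ((P x).1 z - g) ^ 2) := by
        simp only [hh]; field_simp
      simp only [ha]
      rw [h3, mul_pow, mul_pow, hs2]
      have h4 : ell * ell * ((P x).1 z - g) ^ 2 ≤ ell * lam * ((P x).1 z - g) ^ 2 := by gcongr
      have h5 := mul_nonneg (sq_nonneg ell) (sq_nonneg (g - ((P x).1 z - g)))
      linarith
    calc _ ≤ ∑ i ∈ Finset.range n,
          ((s * ell * g + 2 * ell ^ 2 * g ^ 2) + ell / lam * h (ω i).1) :=
          Finset.sum_le_sum fun i _ => h1 _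
      _ = _ := by
          rw [Finset.sum_add_distrib, Finset.sum_const, Finset.card_range, nsmul_eq_mul,
            ← Finset.mul_sum, mul_sub, ← mul_assoc θ,
            show θ * (1 / m) = ell / lam by rw [hθ]; field_simp]
          ring
  have hexp : ∀ ω : ℕ → S × ℝ,
      ENNReal.ofReal (Real.exp (∑ i ∈ Finset.range n, (a (ω i).1 + a (ω i).1 ^ 2))) ≤
      ENNReal.ofReal (Real.exp (n * (s * ell * g + 2 * ell ^ 2 * g ^ 2) + θ * Bd)) *
        (1 + ENNReal.ofReal (Real.exp (-Bd)) *
          ENNReal.ofReal (Real.exp ((1 / m) * ∑ i ∈ Finset.range n, h (ω i).1))) := by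
    intro ω
    rw [← ENNReal.ofReal_mul (Real.exp_pos _).le, ← ENNReal.ofReal_one,
      ← ENNReal.ofReal_add zero_le_one (by positivity), ← ENNReal.ofReal_mul (Real.exp_pos _).le]
    refine ENNReal.ofReal_le_ofReal ((Real.exp_le_exp.2 (hpt ω)).trans ?_)
    rw [Real.exp_add (_ + _)]
    refine mul_le_mul_of_nonneg_left ?_ (Real.exp_pos _).le
    rw [← Real.exp_add, neg_add_eq_sub]
    -- `exp (θ u) ≤ 1 + exp u` for `0 ≤ θ ≤ 1` absorbs the passage from scale `ell` to `lam`
    generalize (1 / m) * ∑ i ∈ Finset.range n, h (ω i).1 - Bd = u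
    rcases le_total 0 u with hu | hu
    · have : Real.exp (θ * u) ≤ Real.exp u := Real.exp_le_exp.2 (mul_le_of_le_one_left hu hθ1)
      linarith
    · have : Real.exp (θ * u) ≤ 1 := Real.exp_le_one_iff.2 (mul_nonpos_of_nonneg_of_nonpos hθ0 hu)
      linarith [Real.exp_pos u]
  have hhm : Measurable h := Measurable.of_discrete
  have hmh : Measurable fun ω : ℕ → S × ℝ =>
      ENNReal.ofReal (Real.exp ((1 / m) * ∑ i ∈ Finset.range n, h (ω i).1)) :=
    ((Finset.measurable_sum _ fun i _ =>
      hhm.comp (measurable_fst.comp (measurable_pi_apply i))).const_mul _).exp.ennreal_ofReal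
  refine (lintegral_exp_hold_le_state ν P haB n).trans ((lintegral_mono hexp).trans ?_)
  rw [lintegral_const_mul _ ((hmh.const_mul _).const_add _),
    lintegral_add_left measurable_const, lintegral_const_mul _ hmh, lintegral_const, measure_univ,
    mul_one, ENNReal.ofReal_mul (Real.exp_pos _).le]
  refine mul_le_mul' (ENNReal.ofReal_le_ofReal (Real.exp_le_exp.2 (by linarith))) ?_
  calc _ ≤ 1 + ENNReal.ofReal (Real.exp (-Bd)) * ENNReal.ofReal (Real.exp Bd) := by gcongr
    _ = ENNReal.ofReal 2 := by
        rw [← ENNReal.ofReal_mul (Real.exp_pos _).le, ← Real.exp_add, neg_add_cancel,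
          Real.exp_zero, ENNReal.ofReal_one, ENNReal.ofReal_ofNat, one_add_one_eq_two]

/-- Concentration of the soft local time of the chain at a state `z`, for both signs `s` of the
deviation: `g` and `V` are the stationary mean and variance of the jump probability to `z`, `B` a
bound for it, and after `m` steps the chain is close to stationarity. -/
lemma measure_softTime_deviation_le [DecidableEq S] {M : Matrix S S ℝ}
    (hM : ∀ x y, M x y = (P x).1 y)
    {π : stdSimplex ℝ S} {m : ℕ} (hm : 0 < m) {g V B ε s : ℝ} (z : S) (hs : s = 1 ∨ s = -1)
    (hg : 0 < g) (hV : 0 < V) (hε : 0 < ε) (hB : ∀ x, (P x).1 z ≤ B)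
    (hmean : ∑ x, π.1 x * (P x).1 z = g) (hvar : ∑ x, π.1 x * ((P x).1 z - g) ^ 2 = V)
    (hεB : 2 * B * g * ε ≤ V)
    (hmix : ∀ x y, (M ^ m) x y ≤ (1 + ε ^ 2 * g ^ 2 / (1024 * V)) * π.1 y) (n : ℕ) :
    pathLaw ν P {ω | n * ε * g / 4 ≤
        s * (∑ i ∈ Finset.range n, (P (ω i).1).1 z * (ω (i + 1)).2 - n * g)} ≤
      ENNReal.ofReal (2 * Real.exp 2 * (Real.exp (-(n * ε ^ 2 / 512)) +
        Real.exp (-(ε ^ 2 * g ^ 2 / V * (n / m) / 1024)))) := by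
  have hm' : (0 : ℝ) < m := by exact_mod_cast hm
  have hn : (0 : ℝ) ≤ n := Nat.cast_nonneg n
  have hp0 : ∀ x, 0 ≤ (P x).1 z := fun x => (P x).2.1 z
  have hgB : g ≤ B := by
    rw [← hmean]
    calc _ ≤ ∑ x, π.1 x * B :=
          Finset.sum_le_sum fun x _ => mul_le_mul_of_nonneg_left (hB x) (π.2.1 x)
      _ = B := by rw [← Finset.sum_mul, π.2.2, one_mul]
  obtain ⟨lam, hlam⟩ : ∃ lam : ℝ, lam = ε * g / (64 * V) := ⟨_, rfl⟩
  have hlam0 : 0 < lam := by rw [hlam]; positivity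
  have hlamB : lam * B ≤ 1 / 128 := by
    rw [hlam, div_mul_eq_mul_div, div_le_iff₀ (by positivity)]
    linarith
  obtain ⟨ell, hell⟩ : ∃ ell : ℝ, ell = min (lam / m) (ε / (32 * g)) := ⟨_, rfl⟩
  have hell0 : 0 < ell := hell ▸ lt_min (by positivity) (by positivity)
  have hell1 : ell ≤ lam / m := hell ▸ min_le_left _ _
  have hell2 : ell ≤ ε / (32 * g) := hell ▸ min_le_right _ _
  have hη : ε ^ 2 * g ^ 2 / (1024 * V) + 4 * lam ^ 2 * V = lam * (ε * g / 8) := by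
    rw [hlam]; field_simp; ring
  have hKq : ∀ x, (transOp P)^[m] (fun y => ENNReal.ofReal (Real.exp
      (lam * (s * ((P y).1 z - g) + 2 * lam * ((P y).1 z - g) ^ 2)))) x ≤
      ENNReal.ofReal (Real.exp (lam * (ε * g / 8))) := by
    rw [← hη]
    refine transOp_exp_le P hM (by positivity) hmix hlam0.le hs ?_ hvar fun x => ?_
    · simp only [mul_sub, Finset.sum_sub_distrib, hmean, ← Finset.sum_mul, π.2.2]
      ring
    · refine (mul_le_mul_of_nonneg_left ?_ hlam0.le).trans hlamB
      exact abs_le.2 ⟨by linarith [hp0 x], by linarith [hB x]⟩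
  have hlap := lintegral_exp_softTime_le ν P hm z hs hg hgB hB hlam0 hlamB hell0 hell1
    (by positivity) hKq n
  have hmX : Measurable fun ω : ℕ → S × ℝ =>
      ∑ i ∈ Finset.range n, s * ell * (P (ω i).1).1 z * (ω (i + 1)).2 := by
    have ham : Measurable fun x : S => s * ell * (P x).1 z := Measurable.of_discrete
    exact Finset.measurable_sum _ fun i _ =>
      (ham.comp (measurable_fst.comp (measurable_pi_apply i))).mul
        (measurable_snd.comp (measurable_pi_apply (i + 1)))
  have hmk := measure_le_of_lintegral_exp_le hmX (c := ell * (n * ε * g / 4 + s * (n * g))) hlap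
  have hset : {ω : ℕ → S × ℝ | ell * (n * ε * g / 4 + s * (n * g)) ≤
      ∑ i ∈ Finset.range n, s * ell * (P (ω i).1).1 z * (ω (i + 1)).2} = {ω | n * ε * g / 4 ≤
        s * (∑ i ∈ Finset.range n, (P (ω i).1).1 z * (ω (i + 1)).2 - n * g)} := by
    ext ω
    have h1 : ∑ i ∈ Finset.range n, s * ell * (P (ω i).1).1 z * (ω (i + 1)).2 =
        ell * (s * ∑ i ∈ Finset.range n, (P (ω i).1).1 z * (ω (i + 1)).2) := by
      rw [Finset.mul_sum, Finset.mul_sum]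
      exact Finset.sum_congr rfl fun i _ => by ring
    simp only [mem_ofPred_eq]
    rw [h1, mul_le_mul_iff_right₀ hell0, mul_sub]
    constructor <;> intro h <;> linarith
  rw [hset] at hmk
  refine hmk.trans (ENNReal.ofReal_le_ofReal ?_)
  have hfin : Real.exp (-(ell * (n * ε * g / 4 + s * (n * g)))) *
      (Real.exp (n * (s * ell * g + 2 * ell ^ 2 * g ^ 2) +
        (2 + n * ell * (lam * (ε * g / 8)) / lam)) * 2) ≤
      2 * Real.exp 2 * Real.exp (-(ell * (ε * n * g / 16))) := by
    rw [← mul_assoc, ← Real.exp_add, mul_assoc 2 (Real.exp 2), ← Real.exp_add, mul_comm _ (2 : ℝ)]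
    refine mul_le_mul_of_nonneg_left (Real.exp_le_exp.2 ?_) zero_le_two
    have h1 : n * ell * (lam * (ε * g / 8)) / lam = ell * (n * ε * g) / 8 := by field_simp
    have h2 : ell * (32 * g) ≤ ε := (le_div_iff₀ (by positivity)).1 hell2
    have h3 := mul_le_mul_of_nonneg_left h2 (show 0 ≤ n * ell * g by positivity)
    rw [h1]
    linarith
  refine hfin.trans (mul_le_mul_of_nonneg_left ?_ (by positivity))
  rcases min_choice (lam / m) (ε / (32 * g)) with h1 | h1
  · have h2 : ell * (ε * n * g / 16) = ε ^ 2 * g ^ 2 / V * (n / m) / 1024 := by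
      rw [hell, h1, hlam]; field_simp; ring
    rw [h2]
    linarith [Real.exp_pos (-(n * ε ^ 2 / 512))]
  · have h2 : ell * (ε * n * g / 16) = n * ε ^ 2 / 512 := by
      rw [hell, h1]; field_simp; ring
    rw [h2]
    linarith [Real.exp_pos (-(ε ^ 2 * g ^ 2 / V * (n / m) / 1024))]

end

/-! ### Mixing and the parameters of the estimate -/

open ChainCoupling

section Matrices

variable {S : Type*} [Fintype S] [DecidableEq S] {P : Matrix S S ℝ} {π : S → ℝ}

lemma vecMul_pow_of_invariant (hπ : Matrix.vecMul π P = π) (n : ℕ) :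
    Matrix.vecMul π (P ^ n) = π := by
  induction n with
  | zero => simp
  | succ n ih => rw [pow_succ, ← Matrix.vecMul_vecMul, ih, hπ]

lemma sum_mul_pow_of_invariant (hπ : IsInvariantDistribution P π) (n : ℕ) (y : S) :
    ∑ x, π x * (P ^ n) x y = π y :=
  congrFun (vecMul_pow_of_invariant hπ.2 n) y

lemma invariant_pos (hP : P.IsIrreducible) (hP0 : ∀ x y, 0 ≤ P x y)
    (hπ : IsInvariantDistribution P π) (z : S) : 0 < π z := by
  have hex := (Matrix.isIrreducible_iff_exists_pow_pos hP0).1 hP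
  obtain ⟨x, hx⟩ : ∃ x, 0 < π x := by
    by_contra h
    push Not at h
    have := Finset.sum_nonpos fun x (_ : x ∈ Finset.univ) => h x
    rw [hπ.1.2] at this
    linarith
  obtain ⟨k, -, hk⟩ := hex x z
  rw [← sum_mul_pow_of_invariant hπ k z]
  refine Finset.sum_pos' (fun y _ => mul_nonneg (hπ.1.1 y) ?_) ⟨x, Finset.mem_univ x, mul_pos hx hk⟩
  exact Matrix.pow_apply_nonneg hP0 k y z

/-- Distances to stationarity halve every mixing time. -/
lemma sum_abs_pow_sub_le (hP : P ∈ Matrix.rowStochastic ℝ S) (hπ : IsInvariantDistribution P π)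
    {T : ℕ} (hT : ∀ x, tvDist ((P ^ T) x) π ≤ 1 / 4) (j : ℕ) (x : S) :
    ∑ y, |(P ^ (T * j)) x y - π y| ≤ 2 * (1 / 2) ^ j := by
  have hrow : ∀ (n : ℕ) (x : S), ∑ y, (P ^ n) x y = 1 := fun n x =>
    Matrix.sum_row_of_mem_rowStochastic (pow_mem hP n) x
  have hnn : ∀ (n : ℕ) (x y : S), 0 ≤ (P ^ n) x y := fun n _ _ =>
    Matrix.nonneg_of_mem_rowStochastic (pow_mem hP n)
  induction j with
  | zero =>
    calc ∑ y, |(P ^ (T * 0)) x y - π y| ≤ ∑ y, ((P ^ (T * 0)) x y + π y) := by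
          refine Finset.sum_le_sum fun y _ => ?_
          have h1 := hnn (T * 0) x y
          have h2 := hπ.1.1 y
          exact abs_le.2 ⟨by linarith, by linarith⟩
      _ = 2 * (1 / 2) ^ 0 := by rw [Finset.sum_add_distrib, hrow, hπ.1.2]; norm_num
  | succ j ih =>
    have hexp : ∀ y, (P ^ (T * (j + 1))) x y - π y =
        ∑ w, ((P ^ (T * j)) x w - π w) * ((P ^ T) w y - π y) := by
      intro y
      have h1 : ∑ w, ((P ^ (T * j)) x w - π w) * ((P ^ T) w y - π y) =
          ∑ w, (P ^ (T * j)) x w * (P ^ T) w y - ∑ w, π w * (P ^ T) w y -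
            ((∑ w, (P ^ (T * j)) x w) - ∑ w, π w) * π y := by
        rw [← Finset.sum_sub_distrib, ← Finset.sum_sub_distrib, Finset.sum_mul,
          ← Finset.sum_sub_distrib]
        exact Finset.sum_congr rfl fun w _ => by ring
      rw [h1, hrow, hπ.1.2, sum_mul_pow_of_invariant hπ, mul_add_one, pow_add, Matrix.mul_apply]
      ring
    calc ∑ y, |(P ^ (T * (j + 1))) x y - π y|
        ≤ ∑ y, ∑ w, |(P ^ (T * j)) x w - π w| * |(P ^ T) w y - π y| := by
          refine Finset.sum_le_sum fun y _ => ?_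
          rw [hexp]
          refine (Finset.abs_sum_le_sum_abs _ _).trans (le_of_eq ?_)
          exact Finset.sum_congr rfl fun w _ => abs_mul _ _
      _ = ∑ w, |(P ^ (T * j)) x w - π w| * ∑ y, |(P ^ T) w y - π y| := by
          rw [Finset.sum_comm]
          exact Finset.sum_congr rfl fun w _ => (Finset.mul_sum _ _ _).symm
      _ ≤ ∑ w, |(P ^ (T * j)) x w - π w| * (1 / 2) := by
          refine Finset.sum_le_sum fun w _ => mul_le_mul_of_nonneg_left ?_ (abs_nonneg _)
          have := hT w
          rw [tvDist] at this
          linarith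
      _ ≤ 2 * (1 / 2) ^ (j + 1) := by
          rw [← Finset.sum_mul, pow_succ]
          linarith

lemma abs_pow_sub_le (hP : P ∈ Matrix.rowStochastic ℝ S) (hπ : IsInvariantDistribution P π)
    {T : ℕ} (hT : ∀ x, tvDist ((P ^ T) x) π ≤ 1 / 4) (j : ℕ) (x y : S) :
    |(P ^ (T * j)) x y - π y| ≤ 2 * (1 / 2) ^ j :=
  (Finset.single_le_sum (f := fun y => |(P ^ (T * j)) x y - π y|) (fun _ _ => abs_nonneg _)
    (Finset.mem_univ y)).trans (sum_abs_pow_sub_le hP hπ hT j x)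

/-- If the chain has a finite mixing time, all states are reached from everywhere in a common
number of steps. -/
lemma exists_pow_ge (hP : P ∈ Matrix.rowStochastic ℝ S) (hπ : IsInvariantDistribution P π)
    {T : ℕ} (hT : ∀ x, tvDist ((P ^ T) x) π ≤ 1 / 4) {z : S} (hz : 0 < π z) :
    ∃ m, ∀ x, π z / 2 ≤ (P ^ m) x z := by
  obtain ⟨j, hj⟩ := exists_pow_lt_of_lt_one (show 0 < π z / 4 by linarith)
    (show (1 / 2 : ℝ) < 1 by norm_num)
  refine ⟨T * j, fun x => ?_⟩
  have := (abs_le.1 (abs_pow_sub_le hP hπ hT j x z)).1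
  linarith

lemma mixingTime_pos {T : ℕ} (hπ : IsInvariantDistribution P π)
    (hT : ∀ x, tvDist ((P ^ T) x) π ≤ 1 / 4) [Nontrivial S] : 0 < T := by
  rcases Nat.eq_zero_or_pos T with rfl | h
  · exfalso
    -- at time `0`, each state would carry stationary mass at least `3 / 4`
    have hmass : ∀ x, 3 / 4 ≤ π x := by
      intro x
      have h1 := hT x
      rw [tvDist, pow_zero, ← Finset.add_sum_erase _ _ (Finset.mem_univ x)] at h1
      have h2 : ∑ y ∈ Finset.univ.erase x, |(1 : Matrix S S ℝ) x y - π y| =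
          ∑ y ∈ Finset.univ.erase x, π y := by
        refine Finset.sum_congr rfl fun y hy => ?_
        rw [Matrix.one_apply_ne (Finset.ne_of_mem_erase hy).symm, zero_sub, abs_neg,
          abs_of_nonneg (hπ.1.1 y)]
      have h3 := Finset.add_sum_erase _ π (Finset.mem_univ x)
      rw [hπ.1.2] at h3
      have h4 := le_abs_self ((1 : Matrix S S ℝ) x x - π x)
      rw [h2] at h1
      rw [Matrix.one_apply_eq] at h1 h4
      linarith
    obtain ⟨x, y, hxy⟩ := exists_pair_ne S
    have h1 := Finset.sum_le_sum_of_subset_of_nonneg (Finset.subset_univ ({x, y} : Finset S))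
      fun w _ _ => hπ.1.1 w
    rw [Finset.sum_pair hxy, hπ.1.2] at h1
    linarith [hmass x, hmass y]
  · exact h

end Matrices

section Parameters

variable {S : Type*} [Fintype S] {P : Matrix S S ℝ} {π μ : S → ℝ}

lemma piVar_rho (hμ : ∀ z, 0 < μ z) (z : S) :
    piVar π (rho P μ z) = piVar π (fun x => P x z) / μ z ^ 2 := by
  have hz := (hμ z).ne'
  have h1 : piMean π (rho P μ z) = piMean π (fun x => P x z) / μ z := by
    simp only [piMean, rho, Finset.sum_div, mul_div_assoc]
  rw [piVar, piVar, h1]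
  generalize piMean π (fun x => P x z) = c
  rw [piMean, piMean, Finset.sum_div]
  refine Finset.sum_congr rfl fun x _ => ?_
  rw [rho, ← sub_div, div_pow, mul_div_assoc]

lemma norm_rho (hμ : ∀ z, 0 < μ z) (z : S) : ‖rho P μ z‖ = ‖fun x => P x z‖ / μ z := by
  have : rho P μ z = (μ z)⁻¹ • fun x => P x z := by
    funext x
    simp [rho, div_eq_inv_mul]
  rw [this, norm_smul, norm_inv, Real.norm_of_nonneg (hμ z).le, div_eq_inv_mul]

/-- The reference measure `μ` cancels from the signal-to-noise ratio. -/
lemma density_sq_div_piVar (hμ : ∀ z, 0 < μ z) (z : S) :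
    density π μ z ^ 2 / piVar π (rho P μ z) = π z ^ 2 / piVar π (fun x => P x z) := by
  have hz := (hμ z).ne'
  rw [piVar_rho hμ, density, div_pow]
  field_simp

lemma piVar_nonneg (hπ : π ∈ stdSimplex ℝ S) (f : S → ℝ) : 0 ≤ piVar π f :=
  Finset.sum_nonneg fun x _ => mul_nonneg (hπ.1 x) (sq_nonneg _)

lemma epsMax_le (hμ : ∀ z, 0 < μ z) (z : S) :
    epsMax P π μ ≤ piVar π (fun x => P x z) / (2 * ‖fun x => P x z‖ * π z) := by
  refine (min_le_right _ _).trans ((ciInf_le (finite_range _).bddBelow z).trans (le_of_eq ?_))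
  have hz := (hμ z).ne'
  rw [piVar_rho hμ, norm_rho hμ, density]
  field_simp

/-- Admissible `ε` force the variances to be positive and dominate `ε`. -/
lemma variance_pos_and_le (hπ : π ∈ stdSimplex ℝ S) (hμ : ∀ z, 0 < μ z) {ε : ℝ} (hε : 0 < ε)
    (hε' : ε ≤ epsMax P π μ) (z : S) :
    0 < piVar π (fun x => P x z) ∧
      2 * ‖fun x => P x z‖ * π z * ε ≤ piVar π (fun x => P x z) := by
  have h := hε'.trans (epsMax_le hμ z)
  have hV := piVar_nonneg hπ (fun x => P x z)
  have hD : 0 ≤ 2 * ‖fun x => P x z‖ * π z := mul_nonneg (by positivity) (hπ.1 z)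
  have hV' : 0 < piVar π (fun x => P x z) := by
    refine hV.lt_of_ne fun h0 => ?_
    rw [← h0, zero_div] at h
    linarith
  have hD' : 0 < 2 * ‖fun x => P x z‖ * π z := by
    refine hD.lt_of_ne fun h0 => ?_
    rw [← h0, div_zero] at h
    linarith
  refine ⟨hV', ?_⟩
  rw [le_div_iff₀ hD'] at h
  linarith

lemma piMean_le_norm (hπ : π ∈ stdSimplex ℝ S) (f : S → ℝ) : piMean π f ≤ ‖f‖ := by
  calc piMean π f ≤ ∑ x, π x * ‖f‖ := Finset.sum_le_sum fun x _ =>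
        mul_le_mul_of_nonneg_left ((le_abs_self _).trans (norm_le_pi_norm f x)) (hπ.1 x)
    _ = ‖f‖ := by rw [← Finset.sum_mul, hπ.2, one_mul]

lemma piStar_le (z : S) : piStar π ≤ π z := ciInf_le (finite_range _).bddBelow z

lemma piStar_pos [Nonempty S] (hπ : ∀ z, 0 < π z) : 0 < piStar π := by
  obtain ⟨z, hz⟩ := exists_eq_ciInf_of_finite (f := π)
  rw [piStar, ← hz]
  exact hπ z

/-- The argument of the logarithm in `kFun` bounds `2 ^ (-k)`. -/
lemma rpow_neg_kFun_le [Nonempty S] (hμ : ∀ z, 0 < μ z) (hπ : ∀ z, 0 < π z) {ε : ℝ} (hε : 0 < ε)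
    (z : S) (hV : 0 < piVar π (fun x => P x z)) :
    (2 : ℝ) ^ (-kFun P π μ ε) ≤
      piStar π * (ε ^ 2 * π z ^ 2 / piVar π (fun x => P x z)) / 6 := by
  have h1 : piStar π * ε ^ 2 * density π μ z ^ 2 / (6 * piVar π (rho P μ z)) =
      piStar π * (ε ^ 2 * π z ^ 2 / piVar π (fun x => P x z)) / 6 := by
    calc _ = piStar π * (ε ^ 2 * (density π μ z ^ 2 / piVar π (rho P μ z))) / 6 := by ring
      _ = _ := by rw [density_sq_div_piVar hμ]; ring
  have h2 : 0 < piStar π * (ε ^ 2 * π z ^ 2 / piVar π (fun x => P x z)) / 6 := by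
    have := piStar_pos hπ
    have := hπ z
    positivity
  have h3 : -kFun P π μ ε ≤
      Real.logb 2 (piStar π * (ε ^ 2 * π z ^ 2 / piVar π (fun x => P x z)) / 6) := by
    rw [kFun, neg_neg, ← h1]
    exact ciInf_le (f := fun z => Real.logb 2
      (piStar π * ε ^ 2 * density π μ z ^ 2 / (6 * piVar π (rho P μ z))))
      (finite_range _).bddBelow z
  calc (2 : ℝ) ^ (-kFun P π μ ε) ≤ 2 ^ Real.logb 2 _ :=
        Real.rpow_le_rpow_of_exponent_le one_le_two h3
    _ = _ := Real.rpow_logb two_pos (by norm_num) h2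

end Parameters

/-- After `m ≤ 6 k(ε) T` steps the chain is close to stationarity in the relative sense required
by the concentration estimate. -/
lemma exists_mixing_steps {S : Type*} [Fintype S] [DecidableEq S] {P : Matrix S S ℝ} {π μ : S → ℝ}
    (hP : P ∈ Matrix.rowStochastic ℝ S) (hπ : IsInvariantDistribution P π) (hπ0 : ∀ z, 0 < π z)
    (hμ : ∀ z, 0 < μ z) [Nonempty S] {T : ℕ} (hT : ∀ x, tvDist ((P ^ T) x) π ≤ 1 / 4) {ε : ℝ}
    (hε : 0 < ε) (hε' : ε ≤ epsMax P π μ) :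
    ∃ m : ℕ, 0 < m ∧ (m : ℝ) ≤ 6 * (kFun P π μ ε * T) ∧ ∀ z x y, (P ^ m) x y ≤
      (1 + ε ^ 2 * π z ^ 2 / (1024 * piVar π (fun x => P x z))) * π y := by
  have hVar := variance_pos_and_le (P := P) hπ.1 hμ hε hε'
  have hε2 : ε ≤ 1 / 2 := hε'.trans (min_le_left _ _)
  have hmean : ∀ z, π z ≤ ‖fun x => P x z‖ := by
    intro z
    have h1 := piMean_le_norm hπ.1 (fun x => P x z)
    have h2 : piMean π (fun x => P x z) = π z := congrFun hπ.2 z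
    rwa [h2] at h1
  -- the signal-to-noise ratio `a`
  have ha : ∀ z, 0 < ε ^ 2 * π z ^ 2 / piVar π (fun x => P x z) ∧
      ε ^ 2 * π z ^ 2 / piVar π (fun x => P x z) ≤ 1 / 4 := by
    intro z
    obtain ⟨hV, hle⟩ := hVar z
    have hz := hπ0 z
    refine ⟨by positivity, ?_⟩
    rw [div_le_iff₀ hV]
    have h1 : π z * π z * ε ≤ ‖fun x => P x z‖ * π z * ε := by
      gcongr
      exact hmean z
    nlinarith [mul_pos (mul_pos hz hz) hε]
  have hnt : Nontrivial S := by
    by_contra h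
    rw [not_nontrivial_iff_subsingleton] at h
    obtain ⟨z⟩ := ‹Nonempty S›
    have h1 := (hVar z).1
    have h2 : ∀ x, P x z = piMean π (fun x => P x z) := by
      intro x
      have h3 : ∀ y, P y z = P x z := fun y => by rw [Subsingleton.elim y x]
      simp only [piMean, h3, ← Finset.sum_mul, hπ.1.2, one_mul]
    have h4 : piVar π (fun x => P x z) = 0 := by
      rw [piVar, piMean]
      exact Finset.sum_eq_zero fun x _ => by rw [← h2 x]; ring
    linarith
  have hTpos : 0 < T := mixingTime_pos hπ hT
  have hstar := piStar_pos hπ0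
  set k := kFun P π μ ε with hk
  have hk2 : ∀ z, (2 : ℝ) ^ (-k) ≤
      piStar π * (ε ^ 2 * π z ^ 2 / piVar π (fun x => P x z)) / 6 := fun z =>
    rpow_neg_kFun_le hμ hπ0 hε z (hVar z).1
  have hk1 : 1 ≤ k := by
    obtain ⟨z⟩ := ‹Nonempty S›
    have h1 := hk2 z
    have hz1 : piStar π ≤ 1 := by
      refine (piStar_le z).trans ?_
      rw [← hπ.1.2]
      exact Finset.single_le_sum (fun x _ => hπ.1.1 x) (Finset.mem_univ z)
    have h2 : piStar π * (ε ^ 2 * π z ^ 2 / piVar π (fun x => P x z)) ≤ 1 * (1 / 4) :=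
      mul_le_mul hz1 (ha z).2 (ha z).1.le zero_le_one
    have h3 : (2 : ℝ) ^ (-k) ≤ 2 ^ (-1 : ℝ) := by
      rw [Real.rpow_neg_one]
      linarith
    have := (Real.rpow_le_rpow_left_iff one_lt_two).1 h3
    linarith
  set K := ⌈k⌉₊ with hK
  have hKk : k ≤ K := Nat.le_ceil k
  have hKk' : (K : ℝ) ≤ 2 * k := by
    have := Nat.ceil_lt_add_one (zero_le_one.trans hk1)
    linarith
  have hKpos : 0 < K := Nat.ceil_pos.2 (by linarith)
  refine ⟨T * (3 * K), by positivity, ?_, fun z x y => ?_⟩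
  · push_cast
    have : (0 : ℝ) ≤ T := Nat.cast_nonneg T
    nlinarith
  · have h1 := (abs_le.1 (abs_pow_sub_le hP hπ hT (3 * K) x y)).2
    have h2 : (1 / 2 : ℝ) ^ K ≤ 2 ^ (-k) := by
      rw [one_div, inv_pow, ← Real.rpow_natCast, ← Real.rpow_neg two_pos.le]
      exact Real.rpow_le_rpow_of_exponent_le one_le_two (by linarith)
    obtain ⟨a, hadef⟩ : ∃ a, a = ε ^ 2 * π z ^ 2 / piVar π (fun x => P x z) := ⟨_, rfl⟩
    have haz := ha z
    have h3 := h2.trans (hk2 z)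
    rw [← hadef] at haz h3
    have hratio : ε ^ 2 * π z ^ 2 / (1024 * piVar π (fun x => P x z)) = a / 1024 := by
      rw [hadef, div_div, mul_comm (1024 : ℝ)]
    have hsy := piStar_le (π := π) y
    have hs1 : piStar π ≤ 1 := by
      refine (piStar_le z).trans ?_
      rw [← hπ.1.2]
      exact Finset.single_le_sum (fun x _ => hπ.1.1 x) (Finset.mem_univ z)
    -- the cube gains a factor `(a / 6) ^ 2` over the bound for `2 ^ (-k)`
    have h4 : (1 / 2 : ℝ) ^ (3 * K) ≤ (1 / 24) ^ 2 * (piStar π * a / 6) := by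
      rw [mul_comm 3 K, pow_mul]
      have h5 : (1 / 2 : ℝ) ^ K ≤ 1 / 24 := by
        have : piStar π * a ≤ 1 * (1 / 4) := mul_le_mul hs1 haz.2 haz.1.le zero_le_one
        linarith
      rw [pow_succ]
      gcongr
    have h6 : piStar π * a ≤ π y * a := mul_le_mul_of_nonneg_right hsy haz.1.le
    have h7 : 0 < π y * a := mul_pos (hπ0 y) haz.1
    rw [hratio]
    linarith

/-! ### Comparison of the two systems -/

section

section Transfer

variable {S Ω Ω' : Type*} [MeasurableSpace S] [DiscreteMeasurableSpace S] [MeasurableSpace Ω]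
  [MeasurableSpace Ω'] {Q : Measure Ω} {f : Ω → Ω'}

lemma isMarkovChain_of_map [Countable S] {P : Matrix S S ℝ} {ν : S → ℝ} {Z : ℕ → Ω' → S}
    (hf : Measurable f) (h : IsMarkovChain P ν (Q.map f) Z) :
    IsMarkovChain P ν Q fun i ω => Z i (f ω) := by
  refine ⟨fun i => (h.measurable i).comp hf, fun n x => ?_⟩
  rw [← h.path_law n x, map_measureReal_apply hf]
  · rfl
  · exact measurableSet_setOfPred.2 <| Measurable.forall fun i => measurable_const.imp <|
      measurableSet_setOfPred.1 <| h.measurable i (MeasurableSet.singleton (x i))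

lemma isIID_of_map {π : S → ℝ} {U : ℕ → Ω' → S} (hf : Measurable f)
    (h : IsIID π (Q.map f) U) : IsIID π Q fun i ω => U i (f ω) := by
  refine ⟨fun i => (h.measurable i).comp hf, ?_, fun i x => ?_⟩
  · have h1 := h.indep
    rw [iIndepFun_iff_measure_inter_preimage_eq_mul] at h1 ⊢
    intro s A hA
    have h2 := h1 s hA
    rw [Measure.map_apply hf (Finset.measurableSet_biInter _ fun i hi =>
      h.measurable i (hA i hi))] at h2
    simp only [preimage_iInter] at h2
    refine h2.trans (Finset.prod_congr rfl fun i hi => ?_)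
    rw [Measure.map_apply hf (h.measurable i (hA i hi))]
    rfl
  · rw [← h.marginal i x, map_measureReal_apply hf]
    · rfl
    · exact h.measurable i (MeasurableSet.singleton x)

end Transfer

section Paths

variable {S : Type*} [Fintype S] {ν ν' : stdSimplex ℝ S} {P P' : S → stdSimplex ℝ S}
  {ω ω' : ℕ → S × ℝ} {z : S}

/-- If two marked chains have the same level of first visit to `z`, the chain which has accumulated
more soft local time at `z` has visited `z` as soon as the other one has. -/
lemma exists_visit_of_softTime_lt (hω : ∀ i, 0 < (ω i).2) (hω' : ∀ i, 0 < (ω' i).2)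
    (hv : ∃ i, (ω i).1 = z)
    (hlevel : (firstLevel ν P ω z).toReal = (firstLevel ν' P' ω' z).toReal) {N N' i : ℕ}
    (hlt : softTime ν' P' N' ω' z < softTime ν P N ω z) (hi : i < N') (hiz : (ω' i).1 = z) :
    ∃ j < N, (ω j).1 = z := by
  by_contra hno
  push Not at hno
  obtain ⟨j, hj⟩ := hv
  have hfin : firstLevel ν P ω z ≠ ∞ :=
    ne_top_of_le_ne_top ENNReal.ofReal_ne_top (firstLevel_le_softTime hω hj)
  have h1 := (ENNReal.ofReal_le_iff_le_toReal hfin).1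
    (softTime_le_firstLevel (ν := ν) (P := P) hω hno)
  have h2 := ENNReal.toReal_mono ENNReal.ofReal_ne_top
    (firstLevel_le_softTime (ν := ν') (P := P') hω' hiz)
  rw [ENNReal.toReal_ofReal (softTime_nonneg hω' _ z)] at h2
  have h3 := softTime_mono (ν := ν') (P := P') hω' (Nat.succ_le_of_lt hi) z
  have h4 := softTime_mono (ν := ν) (P := P) hω (Nat.le_succ N) z
  linarith

lemma softTime_const (π : stdSimplex ℝ S) (N : ℕ) (ω : ℕ → S × ℝ) (z : S) :
    softTime π (fun _ => π) N ω z = (∑ i ∈ Finset.range N, (ω i).2) * π.1 z := by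
  rw [softTime, Finset.sum_mul]
  refine Finset.sum_congr rfl fun i _ => ?_
  cases i <;> rfl

lemma softTime_succ_eq (n : ℕ) (ω : ℕ → S × ℝ) (z : S) :
    softTime ν P (n + 1) ω z =
      ∑ i ∈ Finset.range n, (P (ω i).1).1 z * (ω (i + 1)).2 + (ω 0).2 * ν.1 z := by
  rw [softTime, Finset.sum_range_succ']
  congr 1
  exact Finset.sum_congr rfl fun i _ => mul_comm _ _

/-- Comparison of the soft local times of the two systems gives the inclusions of the ranges. -/
lemma mem_goodEvent {π : stdSimplex ℝ S} {p : (ℕ → S × ℝ) × (ℕ → S × ℝ)}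
    (h1 : ∀ i, 0 < (p.1 i).2) (h2 : ∀ i, 0 < (p.2 i).2)
    (hv1 : ∀ z, ∃ i, (p.1 i).1 = z) (hv2 : ∀ z, ∃ i, (p.2 i).1 = z)
    (hlevel : ∀ z, (firstLevel ν P p.1 z).toReal = (firstLevel π (fun _ => π) p.2 z).toReal)
    {n : ℕ} {ε : ℝ} (hε : 0 < ε)
    (hlow : ∀ z, softTime π (fun _ => π) (⌊n * (1 - ε)⌋₊ + 1) p.2 z < softTime ν P (n + 1) p.1 z)
    (hupp : ∀ z, softTime ν P (n + 1) p.1 z <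
      softTime π (fun _ => π) (⌊n * (1 + ε)⌋₊ + 1) p.2 z) :
    p ∈ goodEvent (fun i (p : (ℕ → S × ℝ) × (ℕ → S × ℝ)) => (p.1 i).1) (fun i p => (p.2 i).1)
      n ε := by
  have hn : (0 : ℝ) ≤ n := Nat.cast_nonneg n
  constructor
  · rintro z ⟨i, hi, hiz⟩
    obtain ⟨j, hj, hjz⟩ := exists_visit_of_softTime_lt h1 h2 (hv1 z) (hlevel z) (hlow z)
      (Nat.lt_succ_of_le (Nat.le_floor hi)) hiz
    exact ⟨j, by exact_mod_cast Nat.lt_succ_iff.1 hj, hjz⟩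
  · rintro z ⟨i, hi, hiz⟩
    obtain ⟨j, hj, hjz⟩ := exists_visit_of_softTime_lt h2 h1 (hv2 z) (hlevel z).symm (hupp z)
      (Nat.lt_succ_of_le (by exact_mod_cast hi)) hiz
    refine ⟨j, ?_, hjz⟩
    exact (Nat.le_floor_iff (by positivity)).1 (Nat.lt_succ_iff.1 hj)

end Paths

variable {S : Type*} [Fintype S] [MeasurableSpace S] [DiscreteMeasurableSpace S]

/-- The laws of the two systems can be coupled so that the levels of first visits agree. -/
lemma exists_coupling_firstLevel (ν π : stdSimplex ℝ S) (P : S → stdSimplex ℝ S) [Nonempty S]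
    (hZ : ∀ᵐ ω ∂pathLaw ν P, ∀ z, ∃ i, (ω i).1 = z)
    (hU : ∀ᵐ ω ∂pathLaw π (fun _ => π), ∀ z, ∃ i, (ω i).1 = z) :
    ∃ Q : Measure ((ℕ → S × ℝ) × (ℕ → S × ℝ)), IsProbabilityMeasure Q ∧
      Q.map Prod.fst = pathLaw ν P ∧ Q.map Prod.snd = pathLaw π (fun _ => π) ∧
      ∀ᵐ p ∂Q, ∀ z,
        (firstLevel ν P p.1 z).toReal = (firstLevel π (fun _ => π) p.2 z).toReal := by
  have hmeas : ∀ (ν : stdSimplex ℝ S) (P : S → stdSimplex ℝ S),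
      Measurable fun ω z => (firstLevel ν P ω z).toReal := fun ν P =>
    measurable_pi_lambda _ fun z =>
      ((measurable_pi_apply z).comp (measurable_firstLevel ν P)).ennreal_toReal
  obtain ⟨Q, hQ, h1, h2, h3⟩ := exists_coupling_of_map_eq (pathLaw ν P) (pathLaw π fun _ => π)
    (hmeas ν P) (hmeas π fun _ => π)
    ((map_firstLevel_eq_pi ν P hZ).trans (map_firstLevel_eq_pi π _ hU).symm)
  exact ⟨Q, hQ, h1, h2, h3.mono fun p hp z => congrFun hp z⟩

variable [DecidableEq S]

lemma ae_exists_visit_of_pow_ge (ν : stdSimplex ℝ S) (P : S → stdSimplex ℝ S) {M : Matrix S S ℝ}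
    (hM : ∀ x y, M x y = (P x).1 y) (hMs : M ∈ Matrix.rowStochastic ℝ S) {m : ℕ} {z : S} {c : ℝ}
    (hc : 0 < c) (hm : ∀ x, c ≤ (M ^ m) x z) :
    ∀ᵐ ω ∂pathLaw ν P, ∃ i, (ω i).1 = z := by
  classical
  refine ae_exists_visit ν P m z (K := ENNReal.ofReal (1 - c)) ?_ fun x => ?_
  · rw [← ENNReal.ofReal_one]
    exact (ENNReal.ofReal_lt_ofReal_iff one_pos).2 (by linarith)
  · rw [iterate_transOp P hM]
    have hpow := pow_mem hMs m
    have h1 : ∀ y, ENNReal.ofReal ((M ^ m) x y) * ({z}ᶜ : Set S).indicator 1 y =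
        ENNReal.ofReal (if y = z then 0 else (M ^ m) x y) := by
      intro y
      by_cases h : y = z <;> simp [h]
    simp_rw [h1]
    rw [← ENNReal.ofReal_sum_of_nonneg]
    · refine ENNReal.ofReal_le_ofReal ?_
      have h2 := Matrix.sum_row_of_mem_rowStochastic hpow x
      rw [← Finset.add_sum_erase _ _ (Finset.mem_univ z)] at h2 ⊢
      have h3 : ∑ y ∈ Finset.univ.erase z, (if y = z then 0 else (M ^ m) x y) =
          ∑ y ∈ Finset.univ.erase z, (M ^ m) x y :=
        Finset.sum_congr rfl fun y hy => if_neg (Finset.ne_of_mem_erase hy)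
      rw [h3, if_pos rfl]
      linarith [hm x]
    · intro y _
      split_ifs
      · exact le_rfl
      · exact Matrix.nonneg_of_mem_rowStochastic hpow

/-- The bound on the probability of the bad event, for a coupling of the two systems in which the
levels of first visits agree. -/
lemma measureReal_compl_goodEvent_le {ν π : stdSimplex ℝ S} {P : S → stdSimplex ℝ S}
    {M : Matrix S S ℝ} (hM : ∀ x y, M x y = (P x).1 y) [Nonempty S]
    {Q : Measure ((ℕ → S × ℝ) × (ℕ → S × ℝ))} (hQ1 : Q.map Prod.fst = pathLaw ν P)
    (hQ2 : Q.map Prod.snd = pathLaw π (fun _ => π))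
    (hZ : ∀ᵐ ω ∂pathLaw ν P, ∀ z, ∃ i, (ω i).1 = z)
    (hU : ∀ᵐ ω ∂pathLaw π (fun _ => π), ∀ z, ∃ i, (ω i).1 = z)
    (hlevel : ∀ᵐ p ∂Q, ∀ z,
      (firstLevel ν P p.1 z).toReal = (firstLevel π (fun _ => π) p.2 z).toReal)
    (hπ0 : ∀ z, 0 < π.1 z) (hinv : ∀ z, ∑ x, π.1 x * (P x).1 z = π.1 z) {ε : ℝ} (hε : 0 < ε)
    (hε2 : ε ≤ 1 / 2) {V : S → ℝ} (hV0 : ∀ z, 0 < V z)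
    (hV : ∀ z, ∑ x, π.1 x * ((P x).1 z - π.1 z) ^ 2 = V z)
    {B : S → ℝ} (hB : ∀ z x, (P x).1 z ≤ B z) (hεB : ∀ z, 2 * B z * π.1 z * ε ≤ V z)
    {m : ℕ} (hm : 0 < m)
    (hmix : ∀ z x y, (M ^ m) x y ≤ (1 + ε ^ 2 * π.1 z ^ 2 / (1024 * V z)) * π.1 y)
    {n : ℕ} (hn : 0 < n) :
    Q.real (goodEvent (fun i (p : (ℕ → S × ℝ) × (ℕ → S × ℝ)) => (p.1 i).1)
        (fun i p => (p.2 i).1) n ε)ᶜ ≤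
      ∑ z, (2 * Real.exp 1 * Real.exp (-(n * ε ^ 2 / 256)) +
        4 * Real.exp 2 * (Real.exp (-(n * ε ^ 2 / 512)) +
          Real.exp (-(ε ^ 2 * π.1 z ^ 2 / V z * (n / m) / 1024))) +
        initTerm π.1 ν.1 (n * ε / 4) z) := by
  have hn' : (0 : ℝ) < n := by exact_mod_cast hn
  set Nlow : ℕ := ⌊n * (1 - ε)⌋₊ + 1 with hNlow
  set Nupp : ℕ := ⌊n * (1 + ε)⌋₊ + 1 with hNupp
  have hNlow' : (Nlow : ℝ) ≤ n * (1 - ε) + 1 := by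
    rw [hNlow]
    push_cast
    have := Nat.floor_le (show 0 ≤ n * (1 - ε) from mul_nonneg hn'.le (by linarith))
    linarith
  have hNupp' : n * (1 + ε) ≤ (Nupp : ℝ) := by
    rw [hNupp]
    push_cast
    exact (Nat.lt_floor_add_one _).le
  -- the exceptional events
  set B₁ : Set (ℕ → S × ℝ) := {ω | n * (1 - 3 * ε / 4) ≤ ∑ i ∈ Finset.range Nlow, (ω i).2} with hB₁
  set B₂ : Set (ℕ → S × ℝ) := {ω | ∑ i ∈ Finset.range Nupp, (ω i).2 ≤ n * (1 + 3 * ε / 4)} with hB₂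
  set D : ℝ → S → Set (ℕ → S × ℝ) := fun s z => {ω | n * ε * π.1 z / 4 ≤
    s * (∑ i ∈ Finset.range n, (P (ω i).1).1 z * (ω (i + 1)).2 - n * π.1 z)} with hD
  set I : S → Set (ℕ → S × ℝ) := fun z =>
    {ω | 0 < ν.1 z ∧ n * ε / 4 * (π.1 z / ν.1 z) ≤ (ω 0).2} with hI
  have hfst : AEMeasurable Prod.fst Q := measurable_fst.aemeasurable
  have hsnd : AEMeasurable Prod.snd Q := measurable_snd.aemeasurable
  have hsub : (goodEvent (fun i (p : (ℕ → S × ℝ) × (ℕ → S × ℝ)) => (p.1 i).1)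
        (fun i p => (p.2 i).1) n ε)ᶜ ≤ᵐ[Q] ⋃ z, (Prod.snd ⁻¹' B₁ ∪ Prod.snd ⁻¹' B₂ ∪
        (Prod.fst ⁻¹' D 1 z ∪ Prod.fst ⁻¹' D (-1) z) ∪ Prod.fst ⁻¹' I z) := by
    filter_upwards [hlevel, ae_of_ae_map hfst (hQ1 ▸ hZ), ae_of_ae_map hsnd (hQ2 ▸ hU),
      ae_of_ae_map hfst (hQ1 ▸ ae_hold_pos ν P),
      ae_of_ae_map hsnd (hQ2 ▸ ae_hold_pos π fun _ => π)] with p h1 h2 h3 h4 h5 hbad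
    by_contra hno
    refine hbad (mem_goodEvent h4 h5 h2 h3 h1 hε (fun z => ?_) fun z => ?_)
    all_goals
      have hz := hπ0 z
      have hnz : p ∉ (Prod.snd ⁻¹' B₁ ∪ Prod.snd ⁻¹' B₂ ∪
        (Prod.fst ⁻¹' D 1 z ∪ Prod.fst ⁻¹' D (-1) z) ∪ Prod.fst ⁻¹' I z) := fun h =>
        hno (mem_iUnion.2 ⟨z, h⟩)
      simp only [mem_union, mem_preimage, not_or, hB₁, hB₂, hD, hI, mem_ofPred_eq, not_le,
        not_and] at hnz
      obtain ⟨⟨⟨g1, g2⟩, g3, g4⟩, g5⟩ := hnz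
      rw [softTime_const, softTime_succ_eq]
    · have h6 := mul_lt_mul_of_pos_right g1 hz
      have h7 : 0 ≤ (p.1 0).2 * ν.1 z := mul_nonneg (h4 0).le (ν.2.1 z)
      have h8 : 0 < n * ε * π.1 z := by positivity
      linarith
    · have h6 := mul_lt_mul_of_pos_right g2 hz
      have h8 : 0 < n * ε * π.1 z := by positivity
      have h7 : (p.1 0).2 * ν.1 z < n * ε / 4 * π.1 z := by
        rcases (ν.2.1 z).eq_or_lt with h0 | h0
        · rw [← h0, mul_zero]
          positivity
        · have := mul_lt_mul_of_pos_right (g5 h0) h0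
          rwa [mul_assoc, div_mul_cancel₀ _ h0.ne'] at this
      linarith
  have hle1 : ∀ A : Set (ℕ → S × ℝ), Q (Prod.fst ⁻¹' A) ≤ pathLaw ν P A := fun A =>
    hQ1 ▸ Measure.le_map_apply hfst A
  have hle2 : ∀ A : Set (ℕ → S × ℝ), Q (Prod.snd ⁻¹' A) ≤ pathLaw π (fun _ => π) A := fun A =>
    hQ2 ▸ Measure.le_map_apply hsnd A
  have hI' : ∀ z, pathLaw ν P (I z) ≤ ENNReal.ofReal (initTerm π.1 ν.1 (n * ε / 4) z) := by
    intro z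
    by_cases h0 : ν.1 z = 0
    · simp [hI, h0]
    · rw [initTerm, if_neg h0]
      refine (measure_mono fun ω hω => hω.2).trans (measure_hold_zero_ge ν P ?_).le
      have := hπ0 z
      have := ν.2.1 z
      positivity
  have hinit0 : ∀ z, 0 ≤ initTerm π.1 ν.1 (n * ε / 4) z := by
    intro z
    rw [initTerm]
    split_ifs <;> positivity
  have hDle : ∀ s z, (s = 1 ∨ s = -1) → pathLaw ν P (D s z) ≤ _ := fun s z hs =>
    measure_softTime_deviation_le ν P hM (π := π) hm z hs (hπ0 z) (hV0 z) hε (hB z) (hinv z)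
      (hV z) (hεB z) (hmix z) n
  have hbound : ∀ z, Q (Prod.snd ⁻¹' B₁ ∪ Prod.snd ⁻¹' B₂ ∪
        (Prod.fst ⁻¹' D 1 z ∪ Prod.fst ⁻¹' D (-1) z) ∪ Prod.fst ⁻¹' I z) ≤
      ENNReal.ofReal (2 * Real.exp 1 * Real.exp (-(n * ε ^ 2 / 256)) +
        4 * Real.exp 2 * (Real.exp (-(n * ε ^ 2 / 512)) +
          Real.exp (-(ε ^ 2 * π.1 z ^ 2 / V z * (n / m) / 1024))) +
        initTerm π.1 ν.1 (n * ε / 4) z) := by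
    intro z
    have e1 := (hle2 B₁).trans (measure_sum_hold_ge_le π (fun _ => π) hε hε2 n Nlow hNlow')
    have e2 := (hle2 B₂).trans (measure_sum_hold_le_le π (fun _ => π) hε hε2 n Nupp hNupp')
    have e3 := (hle1 (D 1 z)).trans (hDle 1 z (Or.inl rfl))
    have e4 := (hle1 (D (-1) z)).trans (hDle (-1) z (Or.inr rfl))
    have e5 := (hle1 (I z)).trans (hI' z)
    refine (measure_union_le _ _).trans ((add_le_add ((measure_union_le _ _).trans (add_le_add
      ((measure_union_le _ _).trans (add_le_add e1 e2))
      ((measure_union_le _ _).trans (add_le_add e3 e4)))) e5).trans (le_of_eq ?_))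
    rw [← ENNReal.ofReal_add (by positivity) (by positivity),
      ← ENNReal.ofReal_add (by positivity) (by positivity),
      ← ENNReal.ofReal_add (by positivity) (by positivity),
      ← ENNReal.ofReal_add (by positivity) (hinit0 z)]
    congr 1
    ring
  refine ENNReal.toReal_le_of_le_ofReal (Finset.sum_nonneg fun z _ =>
    add_nonneg (by positivity) (hinit0 z)) ?_
  refine (measure_mono_ae hsub).trans ((measure_iUnion_fintype_le _ _).trans ?_)
  rw [ENNReal.ofReal_sum_of_nonneg fun z _ => add_nonneg (by positivity) (hinit0 z)]
  exact Finset.sum_le_sum fun z _ => hbound z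

end

end

end SoftLocalTime


open SoftLocalTime ChainCoupling in
theorem theorem3p1 :
    ∃ c C : ℝ, 0 < c ∧ 0 < C ∧
      ∀ (S : Type u) [Fintype S] [DecidableEq S] [MeasurableSpace S] [DiscreteMeasurableSpace S]
        (P : Matrix S S ℝ) (ν π μ : S → ℝ),
        P ∈ Matrix.rowStochastic ℝ S → P.IsIrreducible →
        ν ∈ stdSimplex ℝ S → ChainCoupling.IsInvariantDistribution P π → (∀ z, 0 < μ z) →
        ∃ (Ω : Type u) (_ : MeasurableSpace Ω) (Q : Measure Ω) (_ : IsProbabilityMeasure Q)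
          (Z U : ℕ → Ω → S),
          ChainCoupling.IsMarkovChain P ν Q Z ∧ ChainCoupling.IsIID π Q U ∧
          ∀ T : ℕ, ChainCoupling.IsMixingTime P π T →
          ∀ ε : ℝ, 0 < ε → ε ≤ ChainCoupling.epsMax P π μ →
          ∀ n : ℕ, 2 * ChainCoupling.kFun P π μ ε * T ≤ n →
            Q.real (ChainCoupling.goodEvent Z U n ε)ᶜ ≤
              C * ∑ z, (Real.exp (-(c * n * ε ^ 2)) +
                ChainCoupling.initTerm π ν (c * n * ε) z +
                Real.exp (-(c * ε ^ 2 * ChainCoupling.density π μ z ^ 2 /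
                    ChainCoupling.piVar π (ChainCoupling.rho P μ z) *
                  (n / (ChainCoupling.kFun P π μ ε * T))))) := by
  refine ⟨1 / 6144, 2 * Real.exp 1 + 4 * Real.exp 2, by norm_num, by positivity, ?_⟩
  intro S _ _ _ _ P ν π μ hP hirr hν hπ hμ
  have hP0 : ∀ x y, 0 ≤ P x y := hP.1
  have hπ0 := invariant_pos hirr hP0 hπ
  have hne : Nonempty S := by
    by_contra h
    rw [not_nonempty_iff] at h
    have := hν.2
    simp at this
  let ν' : stdSimplex ℝ S := ⟨ν, hν⟩
  let π' : stdSimplex ℝ S := ⟨π, hπ.1⟩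
  let P' : S → stdSimplex ℝ S := fun x =>
    ⟨P x, hP0 x, Matrix.sum_row_of_mem_rowStochastic hP x⟩
  have hM : ∀ x y, P x y = (P' x).1 y := fun _ _ => rfl
  have hU : ∀ᵐ ω ∂pathLaw π' (fun _ => π'), ∀ z, ∃ i, (ω i).1 = z := by
    refine ae_all_iff.2 fun z => ?_
    refine ae_exists_visit_of_pow_ge π' (fun _ => π') (M := Matrix.of fun _ => π) (fun _ _ => rfl)
      ?_ (hπ0 z) (m := 1) fun x => ?_
    · exact Matrix.mem_rowStochastic_iff_sum.2 ⟨fun _ => hπ.1.1, fun _ => hπ.1.2⟩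
    · rw [pow_one]
      rfl
  by_cases hmixing : ∃ T, IsMixingTime P π T
  · obtain ⟨T₀, hT₀⟩ := hmixing
    have hZ : ∀ᵐ ω ∂pathLaw ν' P', ∀ z, ∃ i, (ω i).1 = z := by
      refine ae_all_iff.2 fun z => ?_
      obtain ⟨m, hm⟩ := exists_pow_ge hP hπ hT₀.1 (hπ0 z)
      exact ae_exists_visit_of_pow_ge ν' P' hM hP (half_pos (hπ0 z)) hm
    obtain ⟨Q, hQ, hQ1, hQ2, hlevel⟩ := exists_coupling_firstLevel ν' π' P' hZ hU
    refine ⟨_, inferInstance, Q, hQ, fun i p => (p.1 i).1, fun i p => (p.2 i).1,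
      isMarkovChain_of_map measurable_fst (hQ1 ▸ isMarkovChain_pathLaw ν' P' hM),
      isIID_of_map measurable_snd (hQ2 ▸ isIID_pathLaw π'), ?_⟩
    intro T hT ε hε hε' n _
    have hε2 : ε ≤ 1 / 2 := hε'.trans (min_le_left _ _)
    obtain ⟨m, hm, hmk, hmix⟩ := exists_mixing_steps hP hπ hπ0 hμ hT.1 hε hε'
    have hVar := variance_pos_and_le (P := P) hπ.1 hμ hε hε'
    have hm' : (0 : ℝ) < m := by exact_mod_cast hm
    have hinit0 : ∀ (z : S) (a : ℝ), 0 ≤ initTerm π ν a z := by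
      intro z a
      rw [initTerm]
      split_ifs <;> positivity
    rcases Nat.eq_zero_or_pos n with rfl | hn
    · -- for `n = 0` the right-hand side is at least `1`
      obtain ⟨z⟩ := hne
      refine measureReal_le_one.trans ?_
      have h1 : (1 : ℝ) ≤ ∑ z, (Real.exp (-(1 / 6144 * ((0 : ℕ) : ℝ) * ε ^ 2)) +
          initTerm π ν (1 / 6144 * ((0 : ℕ) : ℝ) * ε) z +
          Real.exp (-(1 / 6144 * ε ^ 2 * density π μ z ^ 2 / piVar π (rho P μ z) *
            (((0 : ℕ) : ℝ) / (kFun P π μ ε * T))))) := by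
        refine le_trans ?_ (Finset.single_le_sum (fun z _ => add_nonneg (add_nonneg
          (Real.exp_pos _).le (hinit0 z _)) (Real.exp_pos _).le) (Finset.mem_univ z))
        have := hinit0 z (1 / 6144 * ((0 : ℕ) : ℝ) * ε)
        simp only [Nat.cast_zero, mul_zero, zero_mul, neg_zero, Real.exp_zero, zero_div] at this ⊢
        linarith
      have h2 : (1 : ℝ) ≤ Real.exp 1 := Real.one_le_exp zero_le_one
      nlinarith [Real.exp_pos 2]
    have hn' : (0 : ℝ) < n := by exact_mod_cast hn
    have hinv : ∀ z, ∑ x, π x * P x z = π z := fun z => congrFun hπ.2 z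
    have hV : ∀ z, ∑ x, π x * (P x z - π z) ^ 2 = piVar π (fun x => P x z) := by
      intro z
      have : piMean π (fun x => P x z) = π z := hinv z
      rw [piVar, this, piMean]
    refine (measureReal_compl_goodEvent_le (π := π') (P := P') (M := P) hM hQ1 hQ2 hZ hU hlevel hπ0
      hinv hε hε2 (fun z => (hVar z).1) hV (B := fun z => ‖fun x => P x z‖)
      (fun z x => (le_abs_self _).trans (norm_le_pi_norm (fun x => P x z) x))
      (fun z => (hVar z).2) hm hmix hn).trans ?_
    rw [Finset.mul_sum]
    refine Finset.sum_le_sum fun z _ => ?_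
    have hnε : 0 ≤ n * ε ^ 2 := by positivity
    have e1 : Real.exp (-(n * ε ^ 2 / 256)) ≤ Real.exp (-(1 / 6144 * n * ε ^ 2)) :=
      Real.exp_le_exp.2 (by linarith)
    have e2 : Real.exp (-(n * ε ^ 2 / 512)) ≤ Real.exp (-(1 / 6144 * n * ε ^ 2)) :=
      Real.exp_le_exp.2 (by linarith)
    have e3 : initTerm π ν (n * ε / 4) z ≤ initTerm π ν (1 / 6144 * n * ε) z := by
      simp only [initTerm]
      split_ifs
      · exact le_rfl
      · have h1 : 0 ≤ n * ε * (π z / ν z) :=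
          mul_nonneg (by positivity) (div_nonneg (hπ0 z).le (hν.1 z))
        exact Real.exp_le_exp.2 (by linarith)
    have e4 : Real.exp (-(ε ^ 2 * π z ^ 2 / piVar π (fun x => P x z) * (n / m) / 1024)) ≤
        Real.exp (-(1 / 6144 * ε ^ 2 * density π μ z ^ 2 / piVar π (rho P μ z) *
          (n / (kFun P π μ ε * T)))) := by
      have h1 : 1 / 6144 * ε ^ 2 * density π μ z ^ 2 / piVar π (rho P μ z) =
          ε ^ 2 * π z ^ 2 / piVar π (fun x => P x z) / 6144 := by
        have := density_sq_div_piVar (P := P) (π := π) hμ z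
        rw [mul_div_assoc, this]
        ring
      have h2 : n / (kFun P π μ ε * T) / 6 ≤ n / (m : ℝ) := by
        rw [div_div, mul_comm _ (6 : ℝ)]
        exact div_le_div_of_nonneg_left hn'.le hm' hmk
      have h3 : 0 < ε ^ 2 * π z ^ 2 / piVar π (fun x => P x z) := by
        have := (hVar z).1
        have := hπ0 z
        positivity
      rw [h1]
      have h4 := mul_le_mul_of_nonneg_left h2 h3.le
      exact Real.exp_le_exp.2 (by linarith)
    have hi := hinit0 z (1 / 6144 * n * ε)
    have hexp1 : 1 ≤ Real.exp 1 := Real.one_le_exp zero_le_one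
    have hexp2 := Real.exp_pos 2
    have f1 := mul_le_mul_of_nonneg_left e1 (show 0 ≤ 2 * Real.exp 1 by positivity)
    have f2 := mul_le_mul_of_nonneg_left (add_le_add e2 e4) (show 0 ≤ 4 * Real.exp 2 by positivity)
    have f3 : initTerm π ν (1 / 6144 * n * ε) z ≤
        (2 * Real.exp 1 + 4 * Real.exp 2) * initTerm π ν (1 / 6144 * n * ε) z :=
      le_mul_of_one_le_left hi (by linarith)
    have f4 : 0 ≤ 2 * Real.exp 1 * Real.exp (-(1 / 6144 * ε ^ 2 * density π μ z ^ 2 /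
        piVar π (rho P μ z) * (n / (kFun P π μ ε * T)))) := by positivity
    change _ + _ + initTerm π ν (n * ε / 4) z ≤ _
    linarith
  · -- without a finite mixing time nothing is claimed about the joint law
    set Q := (pathLaw ν' P').prod (pathLaw π' fun _ => π') with hQ
    have hQ1 : Q.map Prod.fst = pathLaw ν' P' := by simp [hQ]
    have hQ2 : Q.map Prod.snd = pathLaw π' fun _ => π' := by simp [hQ]
    exact ⟨_, inferInstance, Q, inferInstance, fun i p => (p.1 i).1, fun i p => (p.2 i).1,
      isMarkovChain_of_map measurable_fst (hQ1 ▸ isMarkovChain_pathLaw ν' P' hM),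
      isIID_of_map measurable_snd (hQ2 ▸ isIID_pathLaw π'), fun T hT => (hmixing ⟨T, hT⟩).elim⟩
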